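/- **Theorem (improved subdivision).** For every constant $C>0$ there is a real polynomial $P_C$ in three variables such that the following holds. Let $B=(X,\{(V_i,C_i)\}_{i=1}^m)$ be a boolean constraint system: $V_i\subseteq X$ is a finite set and $\emptyset\neq C_i\subseteq\mathbb{Z}_2^{V_i}$ for each $i\in[m]$. Let $B'=(X,\{(V_{ij},D_{ij})\}_{1\le i\le m,\,1\le j\le m_i})$ be a subdivision of $B$, that is, a boolean constraint system such that $m_i\ge 1$ for all $i$ and 1. $V_{ij}\subseteq V_i$ for all $i,j$; 2. for all $i$ and all $x,y\in V_i$ there is a $j$ with $x,y\in V_{ij}$; 3. $C_i=\bigwedge_{j=1}^{m_i}D_{ij}$ for all $i$, i.e. $\phi\in\mathbb{Z}_2^{V_i}$ lies in $C_i$ if and only if $\phi|_{V_{ij}}\in D_{ij}$ for all $j$. Let $\pi$ be a probability distribution on $[m]\times[m]$ that is $C$-diagonally dominant: $\pi(i,i)\ge C\sum_{k}\pi(i,k)$ and $\pi(i,i)\ge C\sum_{k}\pi(k,i)$ for all $i$. Put $\pi_{sub}(ij,kl)=\pi(i,k)/(m_im_k)$. Let $L=\max_{i,j}|V_{ij}|$,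 $M=\max_i m_i$ and $K=\max_i|V_i|$. Then for every tracial state $\tau$ on $\mathcal{A}_{c-c}(B')$ there is a tracial state $\widetilde\tau$ on $\mathcal{A}_{c-c}(B)$ with $$\mathrm{def}(\widetilde\tau;B,\pi)\;\le\;P_C(2^L,M,K)\cdot\mathrm{def}(\tau;B',\pi_{sub}).$$ In particular the factor does not depend on the number $m$ of constraints. Here, for a boolean constraint system $S=(X,\{(W_a,E_a)\}_{a\in I})$ with $I$ finite, $\mathcal{A}(W_a,E_a)$ is the quotient of the group $*$-algebra $\mathbb{C}\mathbb{Z}_2^{W_a}$ by the ideal generated by the projections $\Phi_{W_a,\phi}=\prod_{x\in W_a}\tfrac12\bigl(1+(-1)^{\phi(x)}x\bigr)$ with $\phi\in\mathbb{Z}_2^{W_a}\setminus E_a$, and $\mathcal{A}_{c-c}(S)$ is the free product of the complex $*$-algebras $\mathcal{A}(W_a,E_a)$, $a\in I$. A tracial state on a complex $*$-algebra is a positive unital hermitian linear functional $\tau$ with $\tau(ab)=\tau(ba)$. For a probability distribution $\rho$ on $I\times I$, the defect of a tracial state $\tau$ on $\mathcal{A}_{c-c}(S)$ is $$\mathrm{def}(\tau;S,\rho)=\sum_{a,b\in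 I}\rho(a,b)\sum_{\substack{\phi\in E_a,\ \psi\in E_b\\ \phi|_{W_a\cap W_b}\ne\psi|_{W_a\cap W_b}}}\|\Phi_{W_a,\phi}\Phi_{W_b,\psi}\|_\tau^2,\qquad \|u\|_\tau^2=\tau(u^*u).$$ -/

import Mathlib

open scoped NNReal ComplexOrder

noncomputable section

/-! ### Tracial states, weight functions and the defect -/

/-- A tracial state on a complex `*`-algebra: a positive, unital, hermitian linear functional
with `τ (a b) = τ (b a)`. -/
structure TracialState (A : Type*) [Ring A] [StarRing A] [Algebra ℂ A] where
  toLinearMap : A →ₗ[ℂ] ℂ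
  map_one : toLinearMap 1 = 1
  map_star : ∀ a, toLinearMap (star a) = star (toLinearMap a)
  nonneg : ∀ a, 0 ≤ toLinearMap (star a * a)
  tracial : ∀ a b, toLinearMap (a * b) = toLinearMap (b * a)

/-- The trace norm `‖a‖_τ = √(τ (a* a))`. -/
def TracialState.norm {A : Type*} [Ring A] [StarRing A] [Algebra ℂ A]
    (τ : TracialState A) (a : A) : ℝ :=
  Real.sqrt (τ.toLinearMap (star a * a)).re

/-- The defect `∑ a, μ a * ‖a‖_τ ^ 2` of a tracial state with respect to a finitely supported
weight function `μ : A → [0, ∞)`. -/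
def TracialState.defect {A : Type*} [Ring A] [StarRing A] [Algebra ℂ A]
    (τ : TracialState A) (μ : A →₀ ℝ≥0) : ℝ :=
  μ.sum fun a w => (w : ℝ) * τ.norm a ^ 2

/-! ### The free product of complex `*`-algebras -/

/-- The free product of a family of complex algebras. -/
def StarFreeProduct {I : Type*} [DecidableEq I] (A : I → Type*) [∀ i, Ring (A i)]
    [∀ i, Algebra ℂ (A i)] : Type _ :=
  LinearAlgebra.FreeProduct ℂ A

namespace StarFreeProduct

section Basic

variable {I : Type*} [DecidableEq I] (A : I → Type*) [∀ i, Ring (A i)] [∀ i, Algebra ℂ (A i)]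

instance : Ring (StarFreeProduct A) :=
  inferInstanceAs (Ring (LinearAlgebra.FreeProduct ℂ A))

instance : Algebra ℂ (StarFreeProduct A) :=
  inferInstanceAs (Algebra ℂ (LinearAlgebra.FreeProduct ℂ A))

/-- The inclusion of the `i`-th factor. -/
def incl (i : I) : A i →ₐ[ℂ] StarFreeProduct A :=
  LinearAlgebra.FreeProduct.ι ℂ A i

/-- The universal property of the free product. -/
def lift {B : Type*} [Ring B] [Algebra ℂ B] (f : ∀ i, A i →ₐ[ℂ] B) : StarFreeProduct A →ₐ[ℂ] B :=
  LinearAlgebra.FreeProduct.lift ℂ A (fun {i} => f i)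

theorem lift_incl {B : Type*} [Ring B] [Algebra ℂ B] (f : ∀ i, A i →ₐ[ℂ] B) (i : I) (a : A i) :
    lift A f (incl A i a) = f i a :=
  congrArg (fun g : A i →ₐ[ℂ] B => g a)
    (LinearAlgebra.FreeProduct.lift_comp_ι ℂ A (fun {i} => f i) (i := i))

theorem hom_ext {B : Type*} [Ring B] [Algebra ℂ B] {f g : StarFreeProduct A →ₐ[ℂ] B}
    (h : ∀ i a, f (incl A i a) = g (incl A i a)) : f = g := by
  have hf := LinearAlgebra.FreeProduct.lift_unique ℂ A
    (fun {i} => f.comp (incl A i)) f (fun i => rfl)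
  have hg := LinearAlgebra.FreeProduct.lift_unique ℂ A
    (fun {i} => f.comp (incl A i)) g (fun i => AlgHom.ext fun a => (h i a).symm)
  exact hf.trans hg.symm

/-- The opposite of a complex algebra, with the conjugate scalar action. An algebra map
`P → ConjOp P` is an antilinear antimultiplicative map `P → P`. -/
def ConjOp (P : Type*) : Type _ := Pᵐᵒᵖ

instance (P : Type*) [Ring P] : Ring (ConjOp P) := inferInstanceAs (Ring Pᵐᵒᵖ)

instance (P : Type*) [Ring P] [Algebra ℂ P] : Algebra ℂ (ConjOp P) :=
  Algebra.compHom Pᵐᵒᵖ (starRingEnd ℂ)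

end Basic

section Star

variable {I : Type*} [DecidableEq I] (A : I → Type*) [∀ i, Ring (A i)] [∀ i, Algebra ℂ (A i)]
  [∀ i, StarRing (A i)] [∀ i, StarModule ℂ (A i)]

/-- The antilinear antimultiplicative map with `σ_i a ↦ σ_i (star a)`. -/
def starHom : StarFreeProduct A →ₐ[ℂ] ConjOp (StarFreeProduct A) :=
  lift A fun i =>
    { toFun := fun a => MulOpposite.op (incl A i (star a))
      map_one' := by rw [star_one, map_one]; rfl
      map_mul' := fun a b => by rw [star_mul, map_mul]; rfl
      map_zero' := by rw [star_zero, map_zero]; rfl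
      map_add' := fun a b => by rw [star_add, map_add]; rfl
      commutes' := fun r => by
        rw [← algebraMap_star_comm, AlgHom.commutes]; rfl }

instance : Star (StarFreeProduct A) where
  star a := MulOpposite.unop (starHom A a)

/-- The inclusions of the factors are `*`-homomorphisms. -/
theorem star_incl (i : I) (a : A i) : star (incl A i a) = incl A i (star a) :=
  congrArg MulOpposite.unop (lift_incl A (B := ConjOp (StarFreeProduct A)) _ i a)

theorem star_mul_aux (a b : StarFreeProduct A) : star (a * b) = star b * star a :=
  congrArg MulOpposite.unop (map_mul (starHom A) a b)

theorem star_add_aux (a b : StarFreeProduct A) : star (a + b) = star a + star b :=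
  congrArg MulOpposite.unop (map_add (starHom A) a b)

theorem star_algebraMap_aux (r : ℂ) :
    star (algebraMap ℂ (StarFreeProduct A) r) = algebraMap ℂ (StarFreeProduct A) (star r) :=
  congrArg MulOpposite.unop ((starHom A).commutes r)

/-- The square of the involution, as an algebra map. -/
def starStar : StarFreeProduct A →ₐ[ℂ] StarFreeProduct A where
  toFun a := star (star a)
  map_one' := by
    have h := star_algebraMap_aux A 1
    rw [star_one, map_one] at h
    rw [h, h]
  map_mul' a b := by rw [star_mul_aux, star_mul_aux]
  map_zero' := by
    have h := star_algebraMap_aux A 0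
    rw [star_zero, map_zero] at h
    rw [h, h]
  map_add' a b := by rw [star_add_aux, star_add_aux]
  commutes' r := by rw [star_algebraMap_aux, star_algebraMap_aux, star_star]

theorem star_star_aux (a : StarFreeProduct A) : star (star a) = a := by
  have h : starStar A = AlgHom.id ℂ _ := hom_ext A fun i a => by
    change star (star (incl A i a)) = incl A i a
    rw [star_incl, star_incl, star_star]
  exact congrArg (fun f : StarFreeProduct A →ₐ[ℂ] StarFreeProduct A => f a) h

instance : StarRing (StarFreeProduct A) where
  star_involutive := star_star_aux A
  star_mul := star_mul_aux A
  star_add := star_add_aux A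

instance : StarModule ℂ (StarFreeProduct A) where
  star_smul r a := by
    rw [Algebra.smul_def, star_mul, star_algebraMap_aux, ← Algebra.commutes, Algebra.smul_def]

end Star

end StarFreeProduct

/-! ### The commutative algebra of a boolean constraint -/

/-- The group `ℤ₂^V`, written multiplicatively. -/
abbrev Z2Pow (V : Type*) : Type _ := Multiplicative (V → ZMod 2)

/-- The group algebra `ℂ ℤ₂^V`. -/
abbrev GroupAlg (V : Type*) : Type _ := MonoidAlgebra ℂ (Z2Pow V)

namespace GroupAlg

variable {V : Type*}

/-- The involution `∑ g, c_g g ↦ ∑ g, conj c_g g⁻¹` of the group algebra. -/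
def starHom (V : Type*) : GroupAlg V →+* GroupAlg V :=
  (MonoidAlgebra.mapDomainRingHom ℂ (invMonoidHom : Z2Pow V →* Z2Pow V)).comp
    (MonoidAlgebra.mapRingHom (Z2Pow V) (starRingEnd ℂ))

theorem starHom_single (g : Z2Pow V) (c : ℂ) :
    starHom V (MonoidAlgebra.single g c) = MonoidAlgebra.single g⁻¹ (star c) := by
  simp [starHom]

theorem starHom_starHom (a : GroupAlg V) : starHom V (starHom V a) = a := by
  induction a using MonoidAlgebra.induction_linear with
  | zero => simp
  | add f g hf hg => rw [map_add, map_add, hf, hg]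
  | single g c => rw [starHom_single, starHom_single, inv_inv, star_star]

/-- The generator `x ∈ V` of `ℂ ℤ₂^V`. -/
def gen (x : V) : GroupAlg V :=
  open Classical in MonoidAlgebra.single (Multiplicative.ofAdd (Pi.single x 1)) 1

/-- The spectral projection `Π_a(x) = (1 + (-1)^a x) / 2`. -/
def proj (a : ZMod 2) (x : V) : GroupAlg V :=
  (1 / 2 : ℂ) • (1 + (-1 : ℂ) ^ a.val • gen x)

/-- The projection `Φ_{V,φ} = ∏_{x ∈ V} Π_{φ(x)}(x)`. -/
def Phi [Fintype V] (φ : V → ZMod 2) : GroupAlg V := ∏ x, proj (φ x) x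

theorem starHom_gen (x : V) : starHom V (gen x) = gen x := by
  classical
  have h : (Multiplicative.ofAdd (Pi.single x 1 : V → ZMod 2))⁻¹
      = Multiplicative.ofAdd (Pi.single x 1) := by
    apply Multiplicative.toAdd.injective
    funext y
    exact ZMod.neg_eq_self_mod_two _
  unfold gen
  rw [starHom_single, star_one]
  convert congrArg (fun g => MonoidAlgebra.single g (1 : ℂ)) h

theorem starHom_smul (c : ℂ) (a : GroupAlg V) : starHom V (c • a) = star c • starHom V a := by
  induction a using MonoidAlgebra.induction_linear with
  | zero => simp
  | add f g hf hg => rw [smul_add, map_add, map_add, smul_add, hf, hg]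
  | single g d =>
    rw [MonoidAlgebra.smul_single, starHom_single, starHom_single, MonoidAlgebra.smul_single]
    simp

theorem starHom_Phi [Fintype V] (φ : V → ZMod 2) : starHom V (Phi φ) = Phi φ := by
  unfold Phi
  rw [map_prod]
  refine Finset.prod_congr rfl fun x _ => ?_
  unfold proj
  rw [starHom_smul, map_add, map_one, starHom_smul, starHom_gen]
  simp

end GroupAlg

section ConstraintAlg

variable {V : Type*} [Fintype V]

/-- The ideal of `ℂ ℤ₂^V` generated by the `Φ_{V,φ}` with `φ ∉ C`. -/
def constraintIdeal (C : Finset (V → ZMod 2)) : Ideal (GroupAlg V) :=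
  Ideal.span {a | ∃ φ, φ ∉ C ∧ a = GroupAlg.Phi φ}

theorem constraintIdeal_le (C : Finset (V → ZMod 2)) :
    constraintIdeal C ≤ (constraintIdeal C).comap (GroupAlg.starHom V) := by
  refine Ideal.span_le.2 ?_
  rintro a ⟨φ, hφ, rfl⟩
  change GroupAlg.starHom V (GroupAlg.Phi φ) ∈ constraintIdeal C
  rw [GroupAlg.starHom_Phi]
  exact Ideal.subset_span ⟨φ, hφ, rfl⟩

/-- The algebra `𝒜(V, C) = ℂ ℤ₂^V / ⟨Φ_{V,φ} : φ ∉ C⟩` of a boolean constraint. -/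
def ConstraintAlg (C : Finset (V → ZMod 2)) : Type _ := GroupAlg V ⧸ constraintIdeal C

namespace ConstraintAlg

variable (C : Finset (V → ZMod 2))

instance : CommRing (ConstraintAlg C) := inferInstanceAs (CommRing (GroupAlg V ⧸ constraintIdeal C))

instance : Algebra ℂ (ConstraintAlg C) :=
  inferInstanceAs (Algebra ℂ (GroupAlg V ⧸ constraintIdeal C))

/-- The quotient map `ℂ ℤ₂^V → 𝒜(V, C)`. -/
def mk : GroupAlg V →ₐ[ℂ] ConstraintAlg C := Ideal.Quotient.mkₐ ℂ (constraintIdeal C)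

theorem mk_surjective : Function.Surjective (mk C) := Ideal.Quotient.mk_surjective

instance : Star (ConstraintAlg C) where
  star := Ideal.quotientMap (constraintIdeal C) (GroupAlg.starHom V) (constraintIdeal_le C)

theorem star_mk (a : GroupAlg V) : star (mk C a) = mk C (GroupAlg.starHom V a) :=
  Ideal.quotientMap_mk

instance : StarRing (ConstraintAlg C) where
  star_involutive a := by
    obtain ⟨a, rfl⟩ := mk_surjective C a
    rw [star_mk, star_mk, GroupAlg.starHom_starHom]
  star_mul a b := by
    obtain ⟨a, rfl⟩ := mk_surjective C a
    obtain ⟨b, rfl⟩ := mk_surjective C b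
    rw [← map_mul, star_mk, star_mk, star_mk, map_mul, map_mul, mul_comm]
  star_add a b := by
    obtain ⟨a, rfl⟩ := mk_surjective C a
    obtain ⟨b, rfl⟩ := mk_surjective C b
    rw [← map_add, star_mk, star_mk, star_mk, map_add, map_add]

instance : StarModule ℂ (ConstraintAlg C) where
  star_smul r a := by
    obtain ⟨a, rfl⟩ := mk_surjective C a
    rw [← map_smul, star_mk, star_mk, GroupAlg.starHom_smul, map_smul]

end ConstraintAlg

end ConstraintAlg

/-! ### Boolean constraint systems -/

/-- A boolean constraint system on the variables `X`, with constraints indexed by `I`: the `i`-th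
constraint consists of a context `V_i ⊆ X` and a set `C_i ⊆ ℤ₂^{V_i}`. -/
structure BCS (X I : Type*) where
  ctx : I → Finset X
  con : ∀ i, Finset (ctx i → ZMod 2)

namespace BCS

variable {X I : Type*}

/-- The assignments `φ ∈ ℤ₂^{V_i}` and `ψ ∈ ℤ₂^{V_j}` agree on `V_i ∩ V_j`. -/
def Agree (B : BCS X I) {i j : I} (φ : B.ctx i → ZMod 2) (ψ : B.ctx j → ZMod 2) : Prop :=
  ∀ (x : X) (hi : x ∈ B.ctx i) (hj : x ∈ B.ctx j), φ ⟨x, hi⟩ = ψ ⟨x, hj⟩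

/-- The largest size of a context. -/
def maxCtx [Fintype I] (B : BCS X I) : ℕ := Finset.univ.sup fun i => (B.ctx i).card

variable [DecidableEq I]

/-- The constraint-constraint algebra, the free product of the `𝒜(V_i, C_i)`. -/
abbrev CCAlg (B : BCS X I) : Type _ := StarFreeProduct fun i => ConstraintAlg (B.con i)

/-- The element `Φ_{V_i,φ}` of the constraint-constraint algebra. -/
def Phi (B : BCS X I) (i : I) (φ : B.ctx i → ZMod 2) : B.CCAlg :=
  StarFreeProduct.incl (fun i => ConstraintAlg (B.con i)) i
    (ConstraintAlg.mk (B.con i) (GroupAlg.Phi φ))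

/-- The weight function of the weighted algebra `𝒜_{c-c}(B, π)`: every pair `φ ∈ C_i`, `ψ ∈ C_j`
that disagrees on `V_i ∩ V_j` puts weight `π (i, j)` on the element `Φ_{V_i,φ} Φ_{V_j,ψ}`
(weights add up where such elements coincide). -/
def ccWeight [Fintype I] (B : BCS X I) (π : I × I → ℝ≥0) : B.CCAlg →₀ ℝ≥0 :=
  open Classical in
  ∑ i, ∑ j, ∑ φ ∈ B.con i, ∑ ψ ∈ B.con j,
    if B.Agree φ ψ then 0 else Finsupp.single (B.Phi i φ * B.Phi j ψ) (π (i, j))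

end BCS

/-- `B' = (X, {(V_ij, D_ij)})` is a subdivision of `B = (X, {(V_i, C_i)})` with `n i` clauses in the
`i`-th constraint. -/
structure IsSubdivision {X : Type*} {m : ℕ} {n : Fin m → ℕ} (B : BCS X (Fin m))
    (B' : BCS X (Σ i : Fin m, Fin (n i))) : Prop where
  one_le : ∀ i, 1 ≤ n i
  subset : ∀ i j, B'.ctx ⟨i, j⟩ ⊆ B.ctx i
  pair : ∀ i, ∀ x ∈ B.ctx i, ∀ y ∈ B.ctx i, ∃ j, x ∈ B'.ctx ⟨i, j⟩ ∧ y ∈ B'.ctx ⟨i, j⟩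
  conj : ∀ i (φ : B.ctx i → ZMod 2),
    φ ∈ B.con i ↔ ∀ j, (fun x : B'.ctx ⟨i, j⟩ => φ ⟨x.1, subset i j x.2⟩) ∈ B'.con ⟨i, j⟩

/-- `π` is `C`-diagonally dominant. -/
def DiagonallyDominant {A : Type*} [Fintype A] (C : ℝ≥0) (π : A × A → ℝ≥0) : Prop :=
  ∀ a, C * ∑ b, π (a, b) ≤ π (a, a) ∧ C * ∑ b, π (b, a) ≤ π (a, a)

/-- The distribution `π_sub (ij, kl) = π (i, k) / (m_i m_k)`. -/
def subDist {m : ℕ} (n : Fin m → ℕ) (π : Fin m × Fin m → ℝ≥0) :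
    (Σ i : Fin m, Fin (n i)) × (Σ i : Fin m, Fin (n i)) → ℝ≥0 :=
  fun p => π (p.1.1, p.2.1) / (n p.1.1 * n p.2.1)

end

namespace TracialState

theorem one_sub_eq_sum {A : Type*} [Ring A] [StarRing A] {Φ : Type*} [Fintype Φ]
    [DecidableEq Φ] {G : Φ → A} (hG : ∑ i, star (G i) * G i = 1) (i : Φ) :
    1 - star (G i) * G i = ∑ j ∈ Finset.univ.erase i, star (G j) * G j := by
  rw [← hG, ← Finset.add_sum_erase _ _ (Finset.mem_univ i), add_sub_cancel_left]

section Basic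

variable {A : Type*} [Ring A] [StarRing A] [Algebra ℂ A] (τ : TracialState A)

/-- The real part of a tracial state. -/
noncomputable def reTr (a : A) : ℝ := (τ.toLinearMap a).re

/-- The square of the trace norm. -/
noncomputable def sq (a : A) : ℝ := τ.reTr (star a * a)

theorem reTr_zero : τ.reTr 0 = 0 := by simp [reTr]

theorem reTr_one : τ.reTr 1 = 1 := by simp [reTr, τ.map_one]

theorem reTr_add (a b : A) : τ.reTr (a + b) = τ.reTr a + τ.reTr b := by simp [reTr]

theorem reTr_sub (a b : A) : τ.reTr (a - b) = τ.reTr a - τ.reTr b := by simp [reTr]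

theorem reTr_neg (a : A) : τ.reTr (-a) = -τ.reTr a := by simp [reTr]

theorem reTr_two_mul (a : A) : τ.reTr (2 * a) = 2 * τ.reTr a := by
  rw [two_mul, reTr_add, two_mul]

theorem reTr_sum {ι : Type*} (s : Finset ι) (f : ι → A) :
    τ.reTr (∑ i ∈ s, f i) = ∑ i ∈ s, τ.reTr (f i) := by simp [reTr]

theorem reTr_mul_comm (a b : A) : τ.reTr (a * b) = τ.reTr (b * a) := by
  rw [reTr, τ.tracial, reTr]

theorem reTr_star (a : A) : τ.reTr (star a) = τ.reTr a := by
  rw [reTr, τ.map_star, reTr]; simp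

theorem reTr_star_mul (a b : A) : τ.reTr (star a * b) = τ.reTr (star b * a) := by
  rw [← reTr_star, star_mul, star_star]

theorem sq_nonneg (a : A) : 0 ≤ τ.sq a := (Complex.le_def.1 (τ.nonneg a)).1

theorem norm_sq (a : A) : τ.norm a ^ 2 = τ.sq a := Real.sq_sqrt (τ.sq_nonneg a)

theorem sq_star (a : A) : τ.sq (star a) = τ.sq a := by
  rw [sq, sq, star_star, reTr_mul_comm]

theorem sq_neg (a : A) : τ.sq (-a) = τ.sq a := by simp [sq]

theorem sq_zero : τ.sq 0 = 0 := by simp [sq, reTr_zero]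

theorem sq_sub_comm (a b : A) : τ.sq (a - b) = τ.sq (b - a) := by
  rw [← sq_neg, neg_sub]

theorem sq_add (a b : A) : τ.sq (a + b) = τ.sq a + 2 * τ.reTr (star a * b) + τ.sq b := by
  simp only [sq, star_add, add_mul, mul_add, reTr_add]
  rw [τ.reTr_star_mul b a]; ring

theorem sq_sub (a b : A) : τ.sq (a - b) = τ.sq a - 2 * τ.reTr (star a * b) + τ.sq b := by
  rw [sub_eq_add_neg, sq_add, sq_neg, mul_neg, reTr_neg]; ring

theorem sq_add_le (a b : A) : τ.sq (a + b) ≤ 2 * τ.sq a + 2 * τ.sq b := by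
  have h := τ.sq_nonneg (a - b)
  rw [sq_sub] at h; rw [sq_add]; linarith

theorem sq_sub_le (a b : A) : τ.sq (a - b) ≤ 2 * τ.sq a + 2 * τ.sq b := by
  rw [sub_eq_add_neg, ← τ.sq_neg b]; exact τ.sq_add_le _ _

theorem sq_add_three_le (a b c : A) : τ.sq (a + b + c) ≤ 3 * (τ.sq a + τ.sq b + τ.sq c) := by
  have h1 := τ.sq_nonneg (a - b)
  have h2 := τ.sq_nonneg (a - c)
  have h3 := τ.sq_nonneg (b - c)
  rw [sq_sub] at h1 h2 h3
  rw [sq_add, sq_add, star_add, add_mul, reTr_add]; linarith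

theorem sq_mul_left (p a : A) : τ.sq (p * a) = τ.reTr (star a * (star p * p) * a) := by
  simp only [sq, star_mul, mul_assoc]

theorem sq_mul_right (a p : A) : τ.sq (a * p) = τ.reTr (a * (p * star p) * star a) := by
  rw [← sq_star, star_mul, sq_mul_left, star_star, star_star]

variable {p : A}

theorem sq_of_isStarProjection (hp : IsStarProjection p) : τ.sq p = τ.reTr p := by
  rw [sq, hp.isSelfAdjoint.star_eq, hp.isIdempotentElem.eq]

theorem sq_mul_projections {q : A} (hp : IsStarProjection p) (hq : IsStarProjection q) :
    τ.sq (p * q) = τ.reTr (p * q) := by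
  rw [sq_mul_left, hq.isSelfAdjoint.star_eq, hp.isSelfAdjoint.star_eq, hp.isIdempotentElem.eq,
    reTr_mul_comm, ← mul_assoc, hq.isIdempotentElem.eq, reTr_mul_comm]

theorem sq_eq_add_of_isStarProjection (hp : IsStarProjection p) (a : A) :
    τ.sq a = τ.sq (p * a) + τ.sq ((1 - p) * a) := by
  rw [sq_mul_left, sq_mul_left, hp.isSelfAdjoint.star_eq, hp.one_sub.isSelfAdjoint.star_eq,
    hp.isIdempotentElem.eq, hp.one_sub.isIdempotentElem.eq, ← reTr_add, sq]
  congr 1; noncomm_ring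

theorem sq_projection_mul_le (hp : IsStarProjection p) (a : A) : τ.sq (p * a) ≤ τ.sq a := by
  rw [τ.sq_eq_add_of_isStarProjection hp a]
  linarith [τ.sq_nonneg ((1 - p) * a)]

theorem sq_mul_projection_le (hp : IsStarProjection p) (a : A) : τ.sq (a * p) ≤ τ.sq a := by
  rw [← sq_star, star_mul, hp.isSelfAdjoint.star_eq, ← τ.sq_star a]
  exact τ.sq_projection_mul_le hp _

/-- Commuting with a projection at most quadruples the squared trace norm. -/
theorem sq_commutator_le (hp : IsStarProjection p) (a : A) :
    τ.sq (a * p - p * a) ≤ 4 * τ.sq a := by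
  have h := τ.sq_sub_le (a * p) (p * a)
  linarith [τ.sq_projection_mul_le hp a, τ.sq_mul_projection_le hp a]

variable {Φ : Type*} [Fintype Φ]

/-- Left multiplication by a resolution of the identity preserves the trace norm. -/
theorem sum_sq_mul_left {G : Φ → A} (hG : ∑ i, star (G i) * G i = 1) (a : A) :
    ∑ i, τ.sq (G i * a) = τ.sq a := by
  simp only [sq_mul_left]
  rw [← reTr_sum, ← Finset.sum_mul, ← Finset.mul_sum, hG, mul_one, sq]

theorem reTr_conj_nonneg (a z : A) : 0 ≤ τ.reTr (star z * (star a * a) * z) := by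
  rw [← sq_mul_left]; exact τ.sq_nonneg _

theorem reTr_mul_nonneg (a b : A) : 0 ≤ τ.reTr ((star a * a) * (star b * b)) := by
  have h := τ.sq_nonneg (b * star a)
  rw [sq, star_mul, star_star] at h
  rw [reTr_mul_comm, ← mul_assoc, reTr_mul_comm]
  simpa only [mul_assoc] using h

theorem reTr_conj_one_sub_nonneg {G : Φ → A} (hG : ∑ i, star (G i) * G i = 1) (i : Φ) (z : A) :
    0 ≤ τ.reTr (star z * (1 - star (G i) * G i) * z) := by
  classical
  rw [one_sub_eq_sum hG, Finset.mul_sum, Finset.sum_mul, reTr_sum]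
  exact Finset.sum_nonneg fun j _ => τ.reTr_conj_nonneg _ _

theorem reTr_one_sub_mul_nonneg {G : Φ → A} (hG : ∑ i, star (G i) * G i = 1) (i : Φ) (z : A) :
    0 ≤ τ.reTr ((1 - star (G i) * G i) * (star z * z)) := by
  have h := τ.reTr_conj_one_sub_nonneg hG i (star z)
  rwa [star_star, mul_assoc, reTr_mul_comm, mul_assoc] at h

/-- Right multiplication by the members of a resolution of the identity contracts the trace
norm. -/
theorem sum_sq_mul_povm_le {G : Φ → A} (hG : ∑ i, star (G i) * G i = 1) (z : A) :
    ∑ i, τ.sq (z * (star (G i) * G i)) ≤ τ.sq z := by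
  have key : ∀ i, τ.sq (z * (star (G i) * G i)) ≤ τ.reTr (z * (star (G i) * G i) * star z) := by
    intro i
    set E := star (G i) * G i with hE
    have hEs : star E = E := by rw [hE, star_mul, star_star]
    have h1 := τ.reTr_conj_one_sub_nonneg hG i (E * star z)
    have h2 := τ.reTr_conj_nonneg (G i) ((1 - E) * star z)
    rw [← hE] at h1 h2
    rw [sq_mul_right, hEs]
    simp only [star_mul, star_star, hEs, star_sub, star_one] at h1 h2
    have h3 : z * E * star z - z * (E * E) * star z
        = z * E * (1 - E) * (E * star z) + z * (1 - E) * E * ((1 - E) * star z) := by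
      noncomm_ring
    have h4 := congrArg τ.reTr h3
    rw [reTr_sub, reTr_add] at h4
    linarith
  refine (Finset.sum_le_sum fun i _ => key i).trans (le_of_eq ?_)
  rw [← reTr_sum, ← Finset.sum_mul, ← Finset.mul_sum, hG, mul_one, ← τ.sq_star z, sq, star_star]

end Basic

section Minkowski

variable {A : Type*} [Ring A] [StarRing A] [Algebra ℂ A] [StarModule ℂ A] (τ : TracialState A)
  {Φ : Type*}

theorem sq_smul (r : ℝ) (a : A) : τ.sq ((r : ℂ) • a) = r ^ 2 * τ.sq a := by
  simp only [sq, reTr, star_smul, smul_mul_smul_comm, map_smul, smul_eq_mul]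
  rw [Complex.star_def, Complex.conj_ofReal, ← Complex.ofReal_mul, Complex.re_ofReal_mul]
  ring

/-- Minkowski's inequality for families. -/
theorem sum_sq_add_le (s : Finset Φ) (u v : Φ → A) {α β : ℝ} (hα : 0 ≤ α) (hβ : 0 ≤ β)
    (hu : ∑ i ∈ s, τ.sq (u i) ≤ α ^ 2) (hv : ∑ i ∈ s, τ.sq (v i) ≤ β ^ 2) :
    ∑ i ∈ s, τ.sq (u i + v i) ≤ (α + β) ^ 2 := by
  set U := ∑ i ∈ s, τ.sq (u i) with hU
  set V := ∑ i ∈ s, τ.sq (v i) with hV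
  set X := ∑ i ∈ s, 2 * τ.reTr (star (u i) * v i) with hX
  have hU0 : 0 ≤ U := Finset.sum_nonneg fun i _ => τ.sq_nonneg _
  have hV0 : 0 ≤ V := Finset.sum_nonneg fun i _ => τ.sq_nonneg _
  have hquad : ∀ r : ℝ, 0 ≤ V * (r * r) + X * r + U := by
    intro r
    have h : ∑ i ∈ s, τ.sq (u i + (r : ℂ) • v i) = V * (r * r) + X * r + U := by
      rw [hU, hV, hX, Finset.sum_mul, Finset.sum_mul, ← Finset.sum_add_distrib,
        ← Finset.sum_add_distrib]
      refine Finset.sum_congr rfl fun i _ => ?_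
      rw [sq_add, sq_smul, mul_smul_comm]
      have : τ.reTr ((r : ℂ) • (star (u i) * v i)) = r * τ.reTr (star (u i) * v i) := by
        simp [reTr]
      rw [this]; ring
    rw [← h]
    exact Finset.sum_nonneg fun i _ => τ.sq_nonneg _
  have hd := discrim_le_zero hquad
  rw [discrim] at hd
  have hX' : X ≤ 2 * (α * β) := by
    refine abs_le_of_sq_le_sq' ?_ (by positivity) |>.2
    have : U * V ≤ α ^ 2 * β ^ 2 := mul_le_mul hu hv hV0 (by positivity)
    nlinarith
  have h : ∑ i ∈ s, τ.sq (u i + v i) = U + X + V := by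
    rw [hU, hV, hX, ← Finset.sum_add_distrib, ← Finset.sum_add_distrib]
    exact Finset.sum_congr rfl fun i _ => τ.sq_add _ _
  rw [h]; nlinarith

end Minkowski

end TracialState

/-- Every element `E = G* G` has a spectral projection for the half-line `[1/2, ∞)`. -/
def HasSpectralCuts (N : Type*) [Ring N] [StarRing N] : Prop :=
  ∀ G : N, ∃ q y z : N, IsStarProjection q ∧ q * (star G * G) = star G * G * q ∧
    q * (2 * (star G * G) - 1) = star y * y ∧ (1 - q) * (1 - 2 * (star G * G)) = star z * z

/-- Every finite family of projections `q i` has subprojections `q' i` with the same join, such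
that the row `(q' i)` has a polar decomposition `q' i = (y* y) (W i)` in which the `W i` are partial
isometries from `q' i` to pairwise orthogonal projections that sum to the join. -/
def HasRowPolar (N : Type*) [Ring N] [StarRing N] : Prop :=
  ∀ (n : ℕ) (q : Fin n → N), (∀ i, IsStarProjection (q i)) →
    ∃ (q' W : Fin n → N) (y : N), (∀ i, IsStarProjection (q' i)) ∧ (∀ i, q' i * q i = q' i) ∧
      (∀ i j, star (W i) * W j = if i = j then q' i else 0) ∧
      (∀ i, star y * y * W i = q' i) ∧ (∀ i, W i * q' i = W i) ∧
      star y * y * (∑ i, W i * star (W i)) = star y * y ∧ ∀ j, (∑ i, W i * star (W i)) * q j = q j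

theorem isStarProjection_sum {N : Type*} [Ring N] [StarRing N] {Φ : Type*} (s : Finset Φ)
    {P : Φ → N} (hP : ∀ i, IsStarProjection (P i)) (horth : ∀ i j, i ≠ j → P i * P j = 0) :
    IsStarProjection (∑ i ∈ s, P i) := by
  classical
  refine ⟨?_, ?_⟩
  · rw [IsIdempotentElem, Finset.sum_mul_sum]
    refine Finset.sum_congr rfl fun i hi => ?_
    rw [Finset.sum_eq_single i (fun j _ hj => horth i j hj.symm) (fun h => absurd hi h),
      (hP i).isIdempotentElem.eq]
  · rw [IsSelfAdjoint, star_sum]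
    exact Finset.sum_congr rfl fun i _ => (hP i).isSelfAdjoint.star_eq

namespace TracialState

variable {N : Type*} [Ring N] [StarRing N] [Algebra ℂ N] (τ : TracialState N)

/-- Bounds for the spectral projection of a member `E` of a resolution of the identity. -/
theorem spectral_cut_bounds {Φ : Type*} [Fintype Φ] {G : Φ → N} (hG : ∑ i, star (G i) * G i = 1)
    (i : Φ) {E q y z : N} (hE : star (G i) * G i = E) (hq : IsStarProjection q)
    (hqE : q * E = E * q) (hy : q * (2 * E - 1) = star y * y)
    (hz : (1 - q) * (1 - 2 * E) = star z * z) :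
    τ.sq (q - E) ≤ τ.reTr (E - E * E) ∧ τ.reTr (q * (1 - E)) ≤ 2 * τ.reTr (E - E * E) ∧
      τ.reTr (E - q) ≤ 2 * τ.reTr (E - E * E) ∧
      ∀ r : N, IsStarProjection r → τ.reTr (q * r) ≤ 2 * τ.reTr (E * r) := by
  have hEs : star E = E := by rw [← hE, star_mul, star_star]
  have hqs := hq.isSelfAdjoint.star_eq
  have hqq := hq.isIdempotentElem.eq
  have hyE := τ.reTr_one_sub_mul_nonneg hG i y
  have hzE := τ.reTr_mul_nonneg (G i) z
  have hqq' : ∀ x, q * (q * x) = q * x := fun x => by rw [← mul_assoc, hqq]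
  have hqE' : ∀ x, q * (E * x) = E * (q * x) := fun x => by rw [← mul_assoc, hqE, mul_assoc]
  -- the part of `E` below the cut
  have hlow := τ.reTr_one_sub_mul_nonneg hG i (G i * (1 - q))
  have hhigh := τ.reTr_one_sub_mul_nonneg hG i (G i * q)
  have hone := τ.reTr_one_sub_mul_nonneg hG i q
  have hl : star (G i * (1 - q)) * (G i * (1 - q)) = E - E * q := by
    rw [star_mul, star_sub, star_one, hqs, mul_assoc, ← mul_assoc (star (G i)), hE]
    simp only [sub_mul, mul_sub, one_mul, mul_one, hqE, hqE', hqq]; abel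
  have hh : star (G i * q) * (G i * q) = E * q := by
    rw [star_mul, hqs, mul_assoc, ← mul_assoc (star (G i)), hE, hqE', hqq]
  rw [hl, hE] at hlow
  rw [hh, hE] at hhigh
  rw [hqs, hqq, hE] at hone
  rw [← hy, hE] at hyE
  rw [← hz, hE] at hzE
  have e1 : (1 - E) * (q * (2 * E - 1)) = 2 * (E * q) - q + E * q - 2 * (E * (E * q)) := by
    simp only [sub_mul, mul_sub, one_mul, mul_one, two_mul, mul_add, hqE]; abel
  have e2 : E * ((1 - q) * (1 - 2 * E)) = E - 2 * (E * E) - E * q + 2 * (E * (E * q)) := by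
    simp only [sub_mul, mul_sub, one_mul, mul_one, two_mul, mul_add, hqE]; abel
  have e3 : (1 - E) * (E - E * q) = E - E * E - E * q + E * (E * q) := by
    simp only [sub_mul, mul_sub, one_mul]; abel
  have e4 : (1 - E) * (E * q) = E * q - E * (E * q) := by simp only [sub_mul, one_mul]
  have e5 : (1 - E) * q = q - E * q := by simp only [sub_mul, one_mul]
  rw [e1] at hyE
  rw [e2] at hzE
  rw [e3] at hlow
  rw [e4] at hhigh
  rw [e5] at hone
  simp only [reTr_add, reTr_sub, reTr_two_mul] at hyE hzE hlow hhigh hone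
  refine ⟨?_, ?_, ?_, ?_⟩
  · rw [sq, star_sub, hqs, hEs]
    simp only [sub_mul, mul_sub, reTr_sub, hqq, hqE]
    linarith
  · simp only [mul_sub, mul_one, reTr_sub, hqE]
    linarith
  · simp only [reTr_sub]
    linarith
  · intro r hr
    have h1 := τ.reTr_mul_nonneg y r
    have h2 := τ.reTr_mul_nonneg (G i * (1 - q)) r
    rw [hl, hr.isSelfAdjoint.star_eq, hr.isIdempotentElem.eq] at h2
    rw [← hy, hr.isSelfAdjoint.star_eq, hr.isIdempotentElem.eq] at h1
    simp only [mul_sub, sub_mul, two_mul, mul_add, add_mul, mul_one, hqE, reTr_sub, reTr_add]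
      at h1 h2
    linarith

section RowPolar

variable {ι : Type*} [Fintype ι] [DecidableEq ι] {q q' W : ι → N} {y : N}

/-- The total overlap of a family of projections. -/
noncomputable def overlap (q : ι → N) : ℝ := τ.sq (∑ i, q i) - τ.reTr (∑ i, q i)

theorem overlap_eq (hq : ∀ i, IsStarProjection (q i)) :
    τ.overlap q = ∑ i, ∑ j ∈ Finset.univ.erase i, τ.sq (q i * q j) := by
  rw [overlap, sq, star_sum, Finset.sum_mul_sum, reTr_sum, reTr_sum, ← Finset.sum_sub_distrib]
  refine Finset.sum_congr rfl fun i _ => ?_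
  rw [← Finset.add_sum_erase _ _ (Finset.mem_univ i), (hq i).isSelfAdjoint.star_eq,
    (hq i).isIdempotentElem.eq, reTr_add, add_sub_cancel_left, reTr_sum]
  exact Finset.sum_congr rfl fun j _ => (τ.sq_mul_projections (hq i) (hq j)).symm

theorem overlap_mono (hq : ∀ i, IsStarProjection (q i)) (hq' : ∀ i, IsStarProjection (q' i))
    (hle : ∀ i, q' i * q i = q' i) : τ.overlap q' ≤ τ.overlap q := by
  rw [τ.overlap_eq hq, τ.overlap_eq hq']
  refine Finset.sum_le_sum fun i _ => Finset.sum_le_sum fun j _ => ?_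
  have hj : q j * q' j = q' j := by
    have := congrArg star (hle j)
    rwa [star_mul, (hq j).isSelfAdjoint.star_eq, (hq' j).isSelfAdjoint.star_eq] at this
  have : q' i * q' j = q' i * (q i * q j) * q' j := by
    rw [← mul_assoc, hle i, mul_assoc, hj]
  rw [this]
  exact (τ.sq_mul_projection_le (hq' j) _).trans (τ.sq_projection_mul_le (hq' i) _)

variable (hq : ∀ i, IsStarProjection (q i)) (hq' : ∀ i, IsStarProjection (q' i))
  (hle : ∀ i, q' i * q i = q' i) (hW : ∀ i j, star (W i) * W j = if i = j then q' i else 0)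
  (hy : ∀ i, star y * y * W i = q' i) (hWq : ∀ i, W i * q' i = W i)
  (hyJ : star y * y * (∑ i, W i * star (W i)) = star y * y)
  (hJ : ∀ j, (∑ i, W i * star (W i)) * q j = q j)

omit [Algebra ℂ N] [Fintype ι] in
include hW hWq in
theorem isStarProjection_row_range (i : ι) : IsStarProjection (W i * star (W i)) := by
  refine ⟨?_, ?_⟩
  · rw [IsIdempotentElem, mul_assoc, ← mul_assoc (star (W i)), hW, if_pos rfl, ← mul_assoc, hWq]
  · rw [IsSelfAdjoint, star_mul, star_star]

omit hWq in
include hq' hW hy hyJ in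
theorem sum_sq_polar_sub_le : ∑ i, τ.sq (W i - q' i) ≤ τ.overlap q' := by
  set R := star y * y with hR
  set J := ∑ i, W i * star (W i) with hJdef
  have hRs : star R = R := by rw [hR, star_mul, star_star]
  have hWR : ∀ i, star (W i) * R = q' i := fun i => by
    have := congrArg star (hy i)
    rwa [star_mul, hRs, (hq' i).isSelfAdjoint.star_eq] at this
  have hT : ∑ i, q' i = R * R := by
    calc ∑ i, q' i = ∑ i, R * (W i * star (W i)) * R := by
          refine Finset.sum_congr rfl fun i _ => ?_
          rw [← mul_assoc R, hy, mul_assoc (q' i), hWR, (hq' i).isIdempotentElem.eq]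
      _ = R * R := by rw [← Finset.sum_mul, ← Finset.mul_sum, ← hJdef, hyJ]
  have key : ∀ i, τ.sq (W i - q' i) ≤ τ.sq (W i - R * q' i) := by
    intro i
    have e : W i - R * q' i = (W i - q' i) + R * (W i - q' i) := by
      rw [mul_sub, hy]; abel
    rw [e, sq_add, ← mul_assoc]
    have h := τ.reTr_conj_nonneg y (W i - q' i)
    rw [← hR] at h
    linarith [τ.sq_nonneg (R * (W i - q' i))]
  have hsum : ∀ i, τ.sq (W i - R * q' i)
      = τ.reTr (R * R * (W i * star (W i)) * (R * R)) - τ.reTr (q' i) := by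
    intro i
    rw [sq_sub, ← mul_assoc (star (W i)), hWR, (hq' i).isIdempotentElem.eq, sq, hW, if_pos rfl]
    have : τ.sq (R * q' i) = τ.reTr (R * R * (W i * star (W i)) * (R * R)) := by
      rw [sq_mul_right, (hq' i).isSelfAdjoint.star_eq, (hq' i).isIdempotentElem.eq, hRs]
      have : R * R * (W i * star (W i)) * (R * R) = R * (R * W i) * (star (W i) * R) * R := by
        simp only [mul_assoc]
      rw [this, hWR, hy, mul_assoc R (q' i) (q' i), (hq' i).isIdempotentElem.eq]
    rw [this]; ring
  refine (Finset.sum_le_sum fun i _ => key i).trans (le_of_eq ?_)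
  simp only [hsum]
  rw [Finset.sum_sub_distrib, ← reTr_sum, ← reTr_sum, ← Finset.sum_mul, ← Finset.mul_sum, ← hJdef,
    mul_assoc R R J, hyJ, overlap, hT, sq, star_mul, hRs]

include hq hq' hle hW hy hWq hyJ hJ in
/-- The polar parts of the row `(q' i)` are close to the `q i`. -/
theorem row_polar_bounds :
    ∑ i, τ.sq (W i * star (W i) - q' i) ≤ 4 * τ.overlap q ∧
      ∑ i, τ.sq (q' i - q i) ≤ τ.overlap q ∧
      τ.reTr (∑ i, q i) - τ.overlap q ≤ τ.reTr (∑ i, W i * star (W i)) := by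
  have hmono := τ.overlap_mono hq hq' hle
  have hpol := τ.sum_sq_polar_sub_le hq' hW hy hyJ
  have hJtr : τ.reTr (∑ i, W i * star (W i)) = τ.reTr (∑ i, q' i) := by
    rw [reTr_sum, reTr_sum]
    refine Finset.sum_congr rfl fun i _ => ?_
    rw [reTr_mul_comm, hW, if_pos rfl]
  have hT : τ.reTr (∑ i, q i) - τ.overlap q ≤ τ.reTr (∑ i, W i * star (W i)) := by
    set J := ∑ i, W i * star (W i) with hJdef
    have hJp : IsStarProjection J :=
      isStarProjection_sum _ (fun i => isStarProjection_row_range hW hWq i) fun i j hij => by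
        rw [mul_assoc, ← mul_assoc (star (W i)), hW, if_neg hij, zero_mul, mul_zero]
    have hJT : J * ∑ i, q i = ∑ i, q i := by
      rw [Finset.mul_sum]; exact Finset.sum_congr rfl fun j _ => hJ j
    have h := τ.sq_nonneg (∑ i, q i - J)
    have hTs : star (∑ i, q i) = ∑ i, q i := by
      rw [star_sum]; exact Finset.sum_congr rfl fun i _ => (hq i).isSelfAdjoint.star_eq
    rw [sq_sub, hTs, reTr_mul_comm, hJT, τ.sq_of_isStarProjection hJp] at h
    rw [overlap]; linarith
  refine ⟨?_, ?_, hT⟩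
  · refine le_trans ?_ (mul_le_mul_of_nonneg_left (hpol.trans hmono) (by norm_num))
    rw [Finset.mul_sum]
    refine Finset.sum_le_sum fun i _ => ?_
    have e : W i * star (W i) - q' i
        = (W i - q' i) * star (W i) + q' i * (star (W i) - q' i) := by
      rw [mul_sub, sub_mul, (hq' i).isIdempotentElem.eq]; abel
    have h1 : τ.sq ((W i - q' i) * star (W i)) ≤ τ.sq (W i - q' i) := by
      refine le_trans (le_of_eq ?_) (τ.sq_mul_projection_le (hq' i) _)
      rw [sq_mul_right, sq_mul_right, star_star, hW, if_pos rfl, (hq' i).isSelfAdjoint.star_eq,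
        (hq' i).isIdempotentElem.eq]
    have h2 : τ.sq (q' i * (star (W i) - q' i)) ≤ τ.sq (W i - q' i) := by
      refine (τ.sq_projection_mul_le (hq' i) _).trans (le_of_eq ?_)
      rw [← sq_star, star_sub, star_star, (hq' i).isSelfAdjoint.star_eq]
    rw [e]
    linarith [τ.sq_add_le ((W i - q' i) * star (W i)) (q' i * (star (W i) - q' i))]
  · have e : ∀ i, τ.sq (q' i - q i) = τ.reTr (q i) - τ.reTr (q' i) := fun i => by
      rw [sq_sub, (hq' i).isSelfAdjoint.star_eq, hle, τ.sq_of_isStarProjection (hq' i),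
        τ.sq_of_isStarProjection (hq i)]
      ring
    simp only [e]
    rw [Finset.sum_sub_distrib, ← reTr_sum, ← reTr_sum, ← hJtr]
    linarith

end RowPolar

/-- A resolution of the identity by projections. -/
structure _root_.IsPVM {N : Type*} [Ring N] [StarRing N] {Φ : Type*} [Fintype Φ] (P : Φ → N) :
    Prop where
  proj : ∀ i, IsStarProjection (P i)
  orth : ∀ i j, i ≠ j → P i * P j = 0
  sum_eq_one : ∑ i, P i = 1

/-- Orthogonalization: a resolution of the identity whose members are nearly projections is
close to a projection-valued one. -/
theorem exists_isPVM_near (hcut : HasSpectralCuts N) (hrow : HasRowPolar N) {Φ : Type*} [Fintype Φ]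
    {G : Φ → N} (hG : ∑ i, star (G i) * G i = 1) :
    ∃ P : Φ → N, IsPVM P ∧
      ∑ i, τ.sq (P i - star (G i) * G i) ≤
        138 * ∑ i, τ.reTr (star (G i) * G i - star (G i) * G i * (star (G i) * G i)) := by
  classical
  obtain ⟨i₀⟩ : Nonempty Φ := by
    by_contra h
    rw [not_nonempty_iff] at h
    have := τ.reTr_one
    rw [← hG, Finset.univ_eq_empty, Finset.sum_empty, reTr_zero] at this
    exact zero_ne_one this
  set E : Φ → N := fun i => star (G i) * G i with hE
  choose q y z hq hqE hy hz using fun i => hcut (G i)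
  have hb := fun i => τ.spectral_cut_bounds hG i (E := E i) rfl (hq i) (hqE i) (hy i) (hz i)
  set η := ∑ i, τ.reTr (E i - E i * E i) with hη
  have hsumE : ∑ i, E i = 1 := hG
  have hover : τ.overlap q ≤ 4 * η := by
    rw [τ.overlap_eq hq, hη, Finset.mul_sum]
    refine Finset.sum_le_sum fun i _ => ?_
    calc ∑ j ∈ Finset.univ.erase i, τ.sq (q i * q j)
        ≤ ∑ j ∈ Finset.univ.erase i, 2 * τ.reTr (q i * E j) := by
          refine Finset.sum_le_sum fun j _ => ?_
          rw [τ.sq_mul_projections (hq i) (hq j), reTr_mul_comm, τ.reTr_mul_comm (q i)]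
          exact (hb j).2.2.2 _ (hq i)
      _ = 2 * τ.reTr (q i * (1 - E i)) := by
          rw [hE, one_sub_eq_sum hG, Finset.mul_sum, reTr_sum, Finset.mul_sum]
      _ ≤ 4 * τ.reTr (E i - E i * E i) := by linarith [(hb i).2.1]
  let f := Fintype.equivFin Φ
  obtain ⟨q₁, W₁, y₁, h1, h2, h3, h4, h5, h6, h7⟩ :=
    hrow _ (fun k => q (f.symm k)) (fun k => hq _)
  set q' : Φ → N := fun i => q₁ (f i) with hq'def
  set W : Φ → N := fun i => W₁ (f i) with hWdef
  have hsumW : ∑ i, W i * star (W i) = ∑ k, W₁ k * star (W₁ k) :=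
    Fintype.sum_equiv f _ _ fun i => rfl
  have hq' : ∀ i, IsStarProjection (q' i) := fun i => h1 _
  have hW : ∀ i j, star (W i) * W j = if i = j then q' i else 0 := fun i j => by
    rw [hWdef, h3]; simp only [f.injective.eq_iff, hq'def]
  have hWq : ∀ i, W i * q' i = W i := fun i => h5 _
  have hle : ∀ i, q' i * q i = q' i := fun i => by simpa using h2 (f i)
  have hJ : ∀ j, (∑ i, W i * star (W i)) * q j = q j := fun j => by
    rw [hsumW]; simpa using h7 (f j)
  obtain ⟨b1, b2, b3⟩ := τ.row_polar_bounds hq hq' hle hW (fun i => h4 (f i)) hWq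
    (by rw [hsumW, h6]) hJ
  set J := ∑ i, W i * star (W i) with hJdef
  have hPp := isStarProjection_row_range hW hWq
  have hPo : ∀ i j, i ≠ j → (W i * star (W i)) * (W j * star (W j)) = 0 := fun i j hij => by
    rw [mul_assoc, ← mul_assoc (star (W i)), hW, if_neg hij, zero_mul, mul_zero]
  have hPJ : ∀ i, W i * star (W i) * J = W i * star (W i) := fun i => by
    rw [hJdef, Finset.mul_sum, Finset.sum_eq_single i (fun j _ hj => hPo i j hj.symm) (by simp),
      (hPp i).isIdempotentElem.eq]
  have hJP : ∀ i, J * (W i * star (W i)) = W i * star (W i) := fun i => by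
    rw [hJdef, Finset.sum_mul, Finset.sum_eq_single i (fun j _ hj => hPo j i hj) (by simp),
      (hPp i).isIdempotentElem.eq]
  have hJp : IsStarProjection J := isStarProjection_sum _ hPp hPo
  set L : Φ → N := fun i => if i = i₀ then 1 - J else 0 with hL
  have hLp : ∀ i, IsStarProjection (L i) := fun i => by
    rw [hL]; dsimp only; split_ifs
    · exact hJp.one_sub
    · exact ⟨by simp [IsIdempotentElem], by simp [IsSelfAdjoint]⟩
  have hPL : ∀ i j, W i * star (W i) * L j = 0 := fun i j => by
    rw [hL]; dsimp only; split_ifs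
    · rw [mul_sub, mul_one, hPJ, sub_self]
    · rw [mul_zero]
  have hLP : ∀ i j, L j * (W i * star (W i)) = 0 := fun i j => by
    rw [hL]; dsimp only; split_ifs
    · rw [sub_mul, one_mul, hJP, sub_self]
    · rw [zero_mul]
  refine ⟨fun i => W i * star (W i) + L i, ⟨fun i => ?_, fun i j hij => ?_, ?_⟩, ?_⟩
  · refine ⟨?_, ?_⟩
    · rw [IsIdempotentElem, mul_add, add_mul, add_mul, hPL, hLP, (hPp i).isIdempotentElem.eq,
        (hLp i).isIdempotentElem.eq, add_zero, zero_add]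
    · exact (hPp i).isSelfAdjoint.add (hLp i).isSelfAdjoint
  · rw [mul_add, add_mul, add_mul, hPL, hLP, hPo i j hij, zero_add, zero_add, zero_add, hL]
    dsimp only
    split_ifs with h h'
    · exact absurd (h.trans h'.symm) hij
    all_goals simp
  · rw [Finset.sum_add_distrib, ← hJdef, hL, Finset.sum_ite_eq' Finset.univ i₀]
    simp
  · have hLtr : ∑ i, τ.sq (L i) = 1 - τ.reTr J := by
      rw [Finset.sum_congr rfl fun i _ => τ.sq_of_isStarProjection (hLp i), ← reTr_sum, hL,
        Finset.sum_ite_eq' Finset.univ i₀, if_pos (Finset.mem_univ _), reTr_sub, reTr_one]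
    have hTq : 1 - τ.reTr (∑ i, q i) ≤ 2 * η := by
      rw [← τ.reTr_one, ← hsumE, ← reTr_sub, ← Finset.sum_sub_distrib, reTr_sum, hη,
        Finset.mul_sum]
      exact Finset.sum_le_sum fun i _ => (hb i).2.2.1
    have hqEs : ∑ i, τ.sq (q i - E i) ≤ η := Finset.sum_le_sum fun i _ => (hb i).1
    have hterm : ∀ i, τ.sq (W i * star (W i) + L i - E i) ≤
        6 * τ.sq (W i * star (W i) - q' i) + 6 * τ.sq (q' i - q i) + 6 * τ.sq (q i - E i)
          + 2 * τ.sq (L i) := fun i => by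
      have e : W i * star (W i) + L i - E i
          = ((W i * star (W i) - q' i) + (q' i - q i) + (q i - E i)) + L i := by abel
      rw [e]
      linarith [τ.sq_add_le ((W i * star (W i) - q' i) + (q' i - q i) + (q i - E i)) (L i),
        τ.sq_add_three_le (W i * star (W i) - q' i) (q' i - q i) (q i - E i)]
    refine (Finset.sum_le_sum fun i _ => hterm i).trans ?_
    simp only [Finset.sum_add_distrib, ← Finset.mul_sum]
    rw [hLtr]
    linarith

end TracialState

section Hilbert

open ContinuousLinearMap

variable {H K : Type*} [NormedAddCommGroup H] [InnerProductSpace ℂ H] [CompleteSpace H]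
  [NormedAddCommGroup K] [InnerProductSpace ℂ K] [CompleteSpace K]

open scoped InnerProductSpace

theorem commute_starProjection {U : Submodule ℂ H} [U.HasOrthogonalProjection] {c : H →L[ℂ] H}
    (hc : ∀ x ∈ U, c x ∈ U) (hc' : ∀ x ∈ U, star c x ∈ U) :
    c * U.starProjection = U.starProjection * c := by
  ext x
  refine (Submodule.eq_starProjection_of_mem_orthogonal
    (hc _ (U.starProjection_apply_mem x)) ?_).symm
  change c x - c (U.starProjection x) ∈ Uᗮ
  rw [← map_sub, Submodule.mem_orthogonal]
  intro u hu
  have := U.sub_starProjection_mem_orthogonal x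
  rw [Submodule.mem_orthogonal] at this
  rw [← adjoint_inner_left]
  exact this _ (hc' u hu)

theorem hasSpectralCuts_centralizer (S : Set (H →L[ℂ] H)) :
    HasSpectralCuts (StarSubalgebra.centralizer ℂ S) := by
  rintro ⟨G, hG⟩
  set h : H →L[ℂ] H := 2 * (star G * G) - 1 with hh
  have hsa : IsSelfAdjoint h := by
    simp [hh, IsSelfAdjoint, star_sub, star_mul, two_mul]
  let f : ℝ → ℝ := fun x => √(max x 0)
  let g : ℝ → ℝ := fun x => √(max (-x) 0)
  have hf : Continuous f := by fun_prop
  have hg : Continuous g := by fun_prop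
  set y := cfc f h with hy
  set z := cfc g h with hz
  have hys : star y = y := (cfc_predicate f h).star_eq
  have hzs : star z = z := (cfc_predicate g h).star_eq
  have hzy : z * y = 0 := by
    rw [hz, hy, ← cfc_mul g f h hg.continuousOn hf.continuousOn, ← cfc_const_zero ℝ h]
    congr 1
    funext x
    rcases le_total x 0 with hx | hx
    · simp [f, hx]
    · simp [g, hx]
  have hyz : y * y - z * z = h := by
    rw [hz, hy, ← cfc_mul g g h hg.continuousOn hg.continuousOn,
      ← cfc_mul f f h hf.continuousOn hf.continuousOn, ← cfc_sub _ _ h (by fun_prop) (by fun_prop)]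
    conv_rhs => rw [← cfc_id ℝ h]
    congr 1
    funext x
    simp only [f, g, id]
    rw [Real.mul_self_sqrt (le_max_right _ _), Real.mul_self_sqrt (le_max_right _ _)]
    rcases le_total x 0 with hx | hx
    · simp [hx]
    · simp [hx]
  have hyz' : y * z = 0 := by
    have := congrArg star hzy
    rwa [star_mul, hys, hzs, star_zero] at this
  set U : Submodule ℂ H := LinearMap.ker (z : H →ₗ[ℂ] H) with hU
  have : CompleteSpace U := (z.isClosed_ker).completeSpace_coe
  set q := U.starProjection with hq
  have hqp : IsStarProjection q := isStarProjection_starProjection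
  have hqy : q * y = y := by
    ext x
    refine Submodule.starProjection_eq_self_iff.2 ?_
    change z (y x) = 0
    rw [← mul_apply_eq_comp, hzy]; rfl
  have hzq : z * q = 0 := by
    ext x
    exact U.starProjection_apply_mem x
  have hqz : q * z = 0 := by
    have := congrArg star hzq
    rwa [star_mul, hzs, hqp.isSelfAdjoint.star_eq, star_zero] at this
  have hyq : y * q = y := by
    have := congrArg star hqy
    rwa [star_mul, hys, hqp.isSelfAdjoint.star_eq] at this
  have hqh : q * h = y * y := by
    rw [← hyz, mul_sub, ← mul_assoc, hqy, ← mul_assoc, hqz, zero_mul, sub_zero]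
  have hhq : h * q = y * y := by
    rw [← hyz, sub_mul, mul_assoc, hyq, mul_assoc, hzq, mul_zero, sub_zero]
  have hcomm : ∀ c, (c * G = G * c ∧ star c * G = G * star c) → Commute h c := by
    rintro c ⟨h1, h2⟩
    have h3 : star G * c = c * star G := by
      have := congrArg star h2
      rwa [star_mul, star_mul, star_star] at this
    have : Commute (star G * G) c := by
      rw [commute_iff_eq, mul_assoc, ← h1, ← mul_assoc, h3, mul_assoc]
    rw [hh]
    exact ((Commute.ofNat_left 2 _).mul_left this).sub_left (Commute.one_left _)
  rw [StarSubalgebra.mem_centralizer_iff] at hG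
  have hG' : ∀ c ∈ S, Commute h c ∧ Commute h (star c) := fun c hc =>
    ⟨hcomm c (hG c hc), hcomm _ ⟨(hG c hc).2, by rw [star_star]; exact (hG c hc).1⟩⟩
  have hmem : ∀ f : ℝ → ℝ, cfc f h ∈ StarSubalgebra.centralizer ℂ S := fun f => by
    rw [StarSubalgebra.mem_centralizer_iff]
    exact fun c hc => ⟨((hG' c hc).1.cfc_real f).symm, ((hG' c hc).2.cfc_real f).symm⟩
  have hqmem : q ∈ StarSubalgebra.centralizer ℂ S := by
    rw [StarSubalgebra.mem_centralizer_iff]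
    have hinv : ∀ c, Commute h c → ∀ x ∈ U, c x ∈ U := fun c hc x hx => by
      have := hc.cfc_real g
      change z (c x) = 0
      rw [← mul_apply_eq_comp, this.eq, mul_apply_eq_comp, (show z x = 0 from hx), map_zero]
    refine fun c hc => ⟨commute_starProjection (hinv _ (hG' c hc).1) (hinv _ (hG' c hc).2),
      commute_starProjection (hinv _ (hG' c hc).2) ?_⟩
    rw [star_star]; exact hinv _ (hG' c hc).1
  refine ⟨⟨q, hqmem⟩, ⟨y, hmem f⟩, ⟨z, hmem g⟩, ?_, ?_, ?_, ?_⟩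
  · exact ⟨Subtype.ext hqp.isIdempotentElem.eq, Subtype.ext hqp.isSelfAdjoint.star_eq⟩
  · apply Subtype.ext
    change q * (star G * G) = star G * G * q
    have : q * h = h * q := hqh.trans hhq.symm
    rw [hh, mul_sub, sub_mul, mul_one, one_mul, sub_left_inj, two_mul, mul_add, add_mul,
      ← two_smul ℂ (q * _), ← two_smul ℂ (_ * q)] at this
    exact smul_right_injective _ (two_ne_zero (α := ℂ)) this
  · apply Subtype.ext
    change q * (2 * (star G * G) - 1) = star y * y
    rw [hys, ← hqh]
  · apply Subtype.ext
    change (1 - q) * (1 - 2 * (star G * G)) = star z * z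
    have : 1 - 2 * (star G * G) = -h := by rw [hh]; abel
    rw [this, sub_mul, one_mul, mul_neg, hqh, hzs, ← hyz]; abel

/-- Polar decomposition of an injective operator. -/
theorem exists_polar (Y : K →L[ℂ] H) (hY : Function.Injective Y) :
    ∃ (W : K →L[ℂ] H) (g : K →L[ℂ] K), adjoint W ∘L W = 1 ∧ adjoint g = g ∧
      W ∘L (g * g) = Y ∧ DenseRange (g * g : K →L[ℂ] K) ∧
      ∀ c : K →L[ℂ] K, Commute (adjoint Y ∘L Y) c → Commute g c := by
  have hpos : 0 ≤ adjoint Y ∘L Y := by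
    rw [nonneg_iff_isPositive]; exact isPositive_adjoint_comp_self Y
  set P := adjoint Y ∘L Y with hP
  set G := CFC.sqrt P with hG
  have hGG : G * G = P := CFC.sqrt_mul_sqrt_self P hpos
  have hG0 : 0 ≤ G := CFC.sqrt_nonneg P
  have hGs : adjoint G = G := (IsSelfAdjoint.of_nonneg hG0).star_eq
  set g := CFC.sqrt G with hg
  have hgg : g * g = G := CFC.sqrt_mul_sqrt_self G hG0
  have hgs : adjoint g = g := (IsSelfAdjoint.of_nonneg (CFC.sqrt_nonneg G)).star_eq
  have hnorm : ∀ x, ‖Y x‖ = ‖G x‖ := by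
    intro x
    have : ⟪Y x, Y x⟫_ℂ = ⟪G x, G x⟫_ℂ := by
      rw [← adjoint_inner_right, ← adjoint_inner_right, hGs]
      change ⟪x, P x⟫_ℂ = ⟪x, (G * G) x⟫_ℂ
      rw [hGG]
    rw [inner_self_eq_norm_sq_to_K, inner_self_eq_norm_sq_to_K] at this
    have h2 : ‖Y x‖ ^ 2 = ‖G x‖ ^ 2 := by exact_mod_cast this
    exact (pow_left_inj₀ (norm_nonneg _) (norm_nonneg _) two_ne_zero).1 h2
  have hdense : DenseRange (G : K →ₗ[ℂ] K) := by
    have h1 : (LinearMap.range (G : K →ₗ[ℂ] K))ᗮ = ⊥ := by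
      rw [Submodule.eq_bot_iff]
      intro x hx
      rw [Submodule.mem_orthogonal] at hx
      have h0 : G x = 0 := by
        refine ext_inner_left ℂ fun v => ?_
        rw [inner_zero_right, ← adjoint_inner_left, hGs]
        exact hx _ ⟨v, rfl⟩
      have : Y x = 0 := by rw [← norm_eq_zero, hnorm, h0, norm_zero]
      exact hY (this.trans (map_zero Y).symm)
    rw [← Submodule.topologicalClosure_eq_top_iff, ← Submodule.dense_iff_topologicalClosure_eq_top]
      at h1
    exact h1
  set W : K →L[ℂ] H := (Y : K →ₗ[ℂ] H).extendOfNorm (G : K →ₗ[ℂ] K) with hW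
  have hWG : ∀ x, W (G x) = Y x := fun x =>
    LinearMap.extendOfNorm_eq hdense ⟨1, fun x => by simpa using (hnorm x).le⟩ x
  refine ⟨W, g, ?_, hgs, ?_, by rw [hgg]; exact hdense, ?_⟩
  · rw [← norm_map_iff_adjoint_comp_self]
    intro x
    refine hdense.induction (P := fun x => ‖W x‖ = ‖x‖) ?_
      (isClosed_eq (by fun_prop) (by fun_prop)) x
    rintro _ ⟨x, rfl⟩
    change ‖W (G x)‖ = ‖G x‖
    rw [hWG, hnorm]
  · rw [hgg]; ext x; exact hWG x
  · intro c hc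
    exact Commute.cfcₙ_nnreal (Commute.cfcₙ_nnreal hc _) _

/-- The polar decomposition of the row `∑ i, A i`, where the `A i` are the adjoints of the inclusions
of the summands of `K`. -/
theorem row_polar_of_injective (S : Set (H →L[ℂ] H)) {ι : Type*} [Fintype ι] [DecidableEq ι]
    {A : ι → K →L[ℂ] H} {q : ι → H →L[ℂ] H}
    (hA : ∀ i j, A i ∘L adjoint (A j) = if i = j then q i else 0)
    (hA1 : ∑ i, adjoint (A i) ∘L A i = 1) (hinj : Function.Injective (∑ i, A i : K →L[ℂ] H))
    (hq : ∀ i, q i ∈ StarSubalgebra.centralizer ℂ S) :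
    ∃ (W : ι → H →L[ℂ] H) (y : H →L[ℂ] H), y ∈ StarSubalgebra.centralizer ℂ S ∧
      (∀ i, W i ∈ StarSubalgebra.centralizer ℂ S) ∧
      (∀ i j, star (W i) * W j = if i = j then q i else 0) ∧
      (∀ i, star y * y * W i = q i) ∧ (∀ i, W i * q i = W i) ∧
      star y * y * (∑ i, W i * star (W i)) = star y * y := by
  set Y : K →L[ℂ] H := ∑ i, A i with hY
  obtain ⟨W, g, hWW, hgs, hWY, hdense, hcomm⟩ := exists_polar Y hinj
  have hWW' : ∀ x, adjoint W (W x) = x := fun x => congrArg (fun T : K →L[ℂ] K => T x) hWW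
  have hWY' : ∀ x, W (g (g x)) = Y x := fun x => congrArg (fun T : K →L[ℂ] H => T x) hWY
  have hA' : ∀ i j x, A i (adjoint (A j) x) = if i = j then q i x else 0 := fun i j x => by
    have := congrArg (fun T : H →L[ℂ] H => T x) (hA i j)
    simp only [comp_apply] at this
    rw [this]; split_ifs <;> rfl
  have hA1' : ∀ x, ∑ i, adjoint (A i) (A i x) = x := fun x => by
    have := congrArg (fun T : K →L[ℂ] K => T x) hA1
    simpa [sum_apply] using this
  have hqA : ∀ i x, q i (A i x) = A i x := fun i x => by
    conv_rhs => rw [← hA1' x, map_sum]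
    simp [hA']
  have hAq : ∀ i x, adjoint (A i) (q i x) = adjoint (A i) x := fun i x => by
    conv_rhs => rw [← hA1' (adjoint (A i) x)]
    rw [Finset.sum_eq_single i]
    · rw [hA', if_pos rfl]
    · intro j _ hj
      rw [hA', if_neg hj, map_zero]
    · simp
  have hYA : ∀ i x, Y (adjoint (A i) x) = q i x := fun i x => by
    simp [hY, sum_apply, hA']
  -- operators on `H` that commute with the `q i` act on `K`
  have hlift : ∀ c : H →L[ℂ] H, (∀ i, c * q i = q i * c) → (∀ i, star c * q i = q i * star c) →
      ∃ d : K →L[ℂ] K, (∀ x, g (d x) = d (g x)) ∧ (∀ x, W (d x) = c (W x)) ∧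
        (∀ x, d (adjoint W x) = adjoint W (c x)) ∧
        ∀ i x, d (adjoint (A i) x) = adjoint (A i) (c x) := by
    have hlift0 : ∀ c : H →L[ℂ] H, (∀ i, c * q i = q i * c) → ∃ d : K →L[ℂ] K,
        (∀ x, d x = ∑ i, adjoint (A i) (c (A i x))) ∧ (∀ x, Y (d x) = c (Y x)) ∧
        ∀ i x, d (adjoint (A i) x) = adjoint (A i) (c x) := by
      intro c hc
      have hc' : ∀ i x, c (q i x) = q i (c x) := fun i x =>
        congrArg (fun T : H →L[ℂ] H => T x) (hc i)
      refine ⟨∑ i, adjoint (A i) ∘L c ∘L A i, fun x => by simp [sum_apply], fun x => ?_,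
        fun i x => ?_⟩
      · simp only [sum_apply, comp_apply, map_sum, hYA, ← hc', hqA]
        rw [← map_sum, hY, sum_apply]
      · simp only [sum_apply, comp_apply, hA']
        rw [Finset.sum_eq_single i]
        · rw [if_pos rfl, hc', hAq]
        · intro j _ hj
          rw [if_neg hj, map_zero, map_zero]
        · simp
    intro c hc hc'
    obtain ⟨d, hd1, hd2, hd3⟩ := hlift0 c hc
    obtain ⟨e, he1, he2, -⟩ := hlift0 (star c) hc'
    have hde : ∀ u v, ⟪d u, v⟫_ℂ = ⟪u, e v⟫_ℂ := fun u v => by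
      rw [hd1, he1, sum_inner, inner_sum]
      refine Finset.sum_congr rfl fun i _ => ?_
      rw [adjoint_inner_left, adjoint_inner_right, star_eq_adjoint, adjoint_inner_right]
    have hgcomm : ∀ (c : H →L[ℂ] H) (d e : K →L[ℂ] K), (∀ u v, ⟪d u, v⟫_ℂ = ⟪u, e v⟫_ℂ) → (∀ x, Y (d x) = c (Y x)) →
        (∀ x, Y (e x) = star c (Y x)) → (∀ x, g (d x) = d (g x)) ∧ ∀ x, W (d x) = c (W x) := by
      intro c d e hde hd he
      have hdY : Commute (adjoint Y ∘L Y) d := by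
        ext x
        refine ext_inner_right ℂ fun v => ?_
        change ⟪adjoint Y (Y (d x)), v⟫_ℂ = ⟪d (adjoint Y (Y x)), v⟫_ℂ
        rw [hd, hde, adjoint_inner_left, adjoint_inner_left, he, star_eq_adjoint,
          adjoint_inner_right]
      have hgd : ∀ x, g (d x) = d (g x) := fun x =>
        congrArg (fun T : K →L[ℂ] K => T x) (hcomm d hdY).eq
      refine ⟨hgd, fun x => ?_⟩
      refine hdense.induction (P := fun x => W (d x) = c (W x)) ?_
        (isClosed_eq (by fun_prop) (by fun_prop)) x
      rintro _ ⟨x, rfl⟩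
      change W (d (g (g x))) = c (W (g (g x)))
      rw [hWY', ← hgd, ← hgd, hWY', hd]
    have h1 := hgcomm c d e hde hd2 he2
    have h2 := hgcomm (star c) e d
      (fun u v => by rw [← inner_conj_symm, ← hde, inner_conj_symm]) he2
      (fun x => by rw [star_star]; exact hd2 x)
    refine ⟨d, h1.1, h1.2, fun x => ?_, hd3⟩
    refine ext_inner_right ℂ fun v => ?_
    rw [hde, adjoint_inner_left, adjoint_inner_left, h2.2, star_eq_adjoint, adjoint_inner_right]
  have hmem : ∀ T : H →L[ℂ] H, (∀ c : H →L[ℂ] H, (∃ d : K →L[ℂ] K, (∀ x, g (d x) = d (g x)) ∧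
      (∀ x, W (d x) = c (W x)) ∧ (∀ x, d (adjoint W x) = adjoint W (c x)) ∧
      ∀ i x, d (adjoint (A i) x) = adjoint (A i) (c x)) → c * T = T * c) →
      T ∈ StarSubalgebra.centralizer ℂ S := by
    intro T hT
    rw [StarSubalgebra.mem_centralizer_iff]
    intro c hc
    have h := fun i => (StarSubalgebra.mem_centralizer_iff ℂ).1 (hq i) c hc
    exact ⟨hT c (hlift c (fun i => (h i).1) (fun i => (h i).2)),
      hT _ (hlift _ (fun i => (h i).2) (fun i => by rw [star_star]; exact (h i).1))⟩
  have hstarW : ∀ i, star (W ∘L adjoint (A i)) = A i ∘L adjoint W := fun i => by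
    rw [star_eq_adjoint, adjoint_comp, adjoint_adjoint]
  have hyy : star (W ∘L g ∘L adjoint W) * (W ∘L g ∘L adjoint W) = Y ∘L adjoint W := by
    rw [star_eq_adjoint, adjoint_comp, adjoint_comp, adjoint_adjoint, hgs]
    ext x
    change W (g (adjoint W (W (g (adjoint W x))))) = Y (adjoint W x)
    rw [hWW', hWY']
  refine ⟨fun i => W ∘L adjoint (A i), W ∘L g ∘L adjoint W, ?_, ?_, ?_, ?_, ?_, ?_⟩
  · refine hmem _ fun c ⟨d, hd1, hd2, hd3, _⟩ => ?_
    ext x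
    change c (W (g (adjoint W x))) = W (g (adjoint W (c x)))
    rw [← hd2, ← hd3, hd1]
  · refine fun i => hmem _ fun c ⟨d, _, hd2, _, hd4⟩ => ?_
    ext x
    change c (W (adjoint (A i) x)) = W (adjoint (A i) (c x))
    rw [← hd2, hd4]
  · intro i j
    rw [hstarW]
    ext x
    change A i (adjoint W (W (adjoint (A j) x))) = _
    rw [hWW', hA']
    split_ifs <;> rfl
  · intro i
    rw [hyy]
    ext x
    change Y (adjoint W (W (adjoint (A i) x))) = _
    rw [hWW', hYA]
  · intro i
    ext x
    change W (adjoint (A i) (q i x)) = W (adjoint (A i) x)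
    rw [hAq]
  · rw [hyy]
    ext x
    simp only [hstarW, mul_apply_eq_comp, sum_apply, comp_apply]
    rw [← map_sum W, hA1', hWW']

/-- Subprojections with the same join that are independent of the preceding ones. -/
theorem exists_independent_subspaces {n : ℕ} (U : Fin n → Submodule ℂ H)
    (hU : ∀ i, IsClosed (U i : Set H)) :
    ∃ V : Fin n → Submodule ℂ H, (∀ i, IsClosed (V i : Set H)) ∧ (∀ i, V i ≤ U i) ∧
      (∀ i, U i ≤ (⨆ j, V j).topologicalClosure) ∧
      (∀ x : Fin n → H, (∀ i, x i ∈ V i) → ∑ i, x i = 0 → x = 0) ∧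
      ∀ c : H →L[ℂ] H, (∀ i, ∀ x ∈ U i, c x ∈ U i) → (∀ i, ∀ x ∈ U i, star c x ∈ U i) →
        ∀ i, ∀ x ∈ V i, c x ∈ V i := by
  set J : Fin n → Submodule ℂ H := fun i => (⨆ j : {j // j < i}, U j).topologicalClosure with hJ
  have hclosed : ∀ i, IsClosed ((U i ⊓ J i : Submodule ℂ H) : Set H) := fun i =>
    (hU i).inter (Submodule.isClosed_topologicalClosure _)
  have hJle : ∀ i j, j < i → U j ≤ J i := fun i j hji =>
    (le_iSup (fun j : {j // j < i} => U j) ⟨j, hji⟩).trans (Submodule.le_topologicalClosure _)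
  refine ⟨fun i => U i ⊓ (U i ⊓ J i)ᗮ, fun i => (hU i).inter (Submodule.isClosed_orthogonal _),
    fun i => inf_le_left, ?_, ?_, ?_⟩
  · intro i
    induction i using WellFoundedLT.induction with
    | ind i ih =>
      have hJi : J i ≤ (⨆ j, U j ⊓ (U j ⊓ J j)ᗮ).topologicalClosure :=
        Submodule.topologicalClosure_minimal _ (iSup_le fun j => ih j.1 j.2)
          (Submodule.isClosed_topologicalClosure _)
      have : CompleteSpace (U i ⊓ J i : Submodule ℂ H) := (hclosed i).completeSpace_coe
      intro x hx
      have h1 := (U i ⊓ J i).starProjection_apply_mem x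
      have h2 := (U i ⊓ J i).sub_starProjection_mem_orthogonal x
      have h3 : x - (U i ⊓ J i).starProjection x ∈ U i ⊓ (U i ⊓ J i)ᗮ :=
        ⟨(U i).sub_mem hx h1.1, h2⟩
      have h4 := Submodule.le_topologicalClosure _
        ((le_iSup (fun j => U j ⊓ (U j ⊓ J j)ᗮ) i) h3)
      have h5 := Submodule.add_mem _ h4 (hJi h1.2)
      rwa [sub_add_cancel] at h5
  · intro x hx hsum
    classical
    by_contra hne
    have hne' : (Finset.univ.filter fun i => x i ≠ 0).Nonempty := by
      obtain ⟨i, hi⟩ := Function.ne_iff.1 hne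
      exact ⟨i, by simpa using hi⟩
    obtain ⟨k, hk, hmax⟩ := Finset.exists_max_image _ id hne'
    have hk0 : x k ≠ 0 := by simpa using hk
    have hgt : ∀ i, k < i → x i = 0 := fun i hi => by
      by_contra h
      exact absurd (hmax i (by simpa using h)) (not_le.2 hi)
    have hxk : x k ∈ J k := by
      have h1 : x k = -∑ i ∈ Finset.univ.erase k, x i := by
        rw [eq_neg_iff_add_eq_zero, Finset.add_sum_erase _ _ (Finset.mem_univ k), hsum]
      rw [h1]
      refine Submodule.neg_mem _ (Submodule.sum_mem _ fun i hi => ?_)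
      rcases lt_trichotomy i k with h | h | h
      · exact hJle k i h (hx i).1
      · exact absurd h (Finset.ne_of_mem_erase hi)
      · rw [hgt i h]; exact Submodule.zero_mem _
    have := (hx k).2
    exact hk0 (inner_self_eq_zero.1 ((Submodule.mem_orthogonal _ _).1 this _ ⟨(hx k).1, hxk⟩))
  · intro c hc hc' i x hx
    refine ⟨hc i x hx.1, (Submodule.mem_orthogonal _ _).2 fun u hu => ?_⟩
    rw [← adjoint_inner_left]
    refine (Submodule.mem_orthogonal _ _).1 hx.2 _ ⟨hc' i u hu.1, ?_⟩
    have hJinv : J i ≤ (J i).comap (star c : H →L[ℂ] H).toLinearMap := by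
      refine Submodule.topologicalClosure_minimal _ (iSup_le fun j y hy => ?_) ?_
      · exact hJle i j.1 j.2 (hc' j y hy)
      · exact (Submodule.isClosed_topologicalClosure _).preimage (star c : H →L[ℂ] H).continuous
    exact hJinv hu.2

theorem hasRowPolar_centralizer (S : Set (H →L[ℂ] H)) :
    HasRowPolar (StarSubalgebra.centralizer ℂ S) := by
  intro n q hq
  have hqp : ∀ i, IsStarProjection (q i : H →L[ℂ] H) := fun i =>
    ⟨congrArg Subtype.val (hq i).isIdempotentElem.eq,
      congrArg Subtype.val (hq i).isSelfAdjoint.star_eq⟩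
  set U : Fin n → Submodule ℂ H := fun i => LinearMap.ker
    ((1 - (q i : H →L[ℂ] H) : H →L[ℂ] H) : H →ₗ[ℂ] H) with hUdef
  have hUmem : ∀ i x, x ∈ U i ↔ (q i : H →L[ℂ] H) x = x := fun i x => by
    rw [hUdef, LinearMap.mem_ker]
    change x - (q i : H →L[ℂ] H) x = 0 ↔ _
    rw [sub_eq_zero, eq_comm]
  have hqU : ∀ i x, (q i : H →L[ℂ] H) x ∈ U i := fun i x => by
    rw [hUmem, ← mul_apply_eq_comp, (hqp i).isIdempotentElem.eq]
  obtain ⟨V, hVc, hVU, hUV, hind, hinv⟩ := exists_independent_subspaces U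
    (fun i => (1 - (q i : H →L[ℂ] H)).isClosed_ker)
  have : ∀ i, CompleteSpace (V i) := fun i => (hVc i).completeSpace_coe
  have hcS : ∀ c ∈ S, (∀ i, ∀ x ∈ U i, c x ∈ U i) ∧ (∀ i, ∀ x ∈ U i, star c x ∈ U i) := by
    intro c hc
    have h := fun i => (StarSubalgebra.mem_centralizer_iff ℂ).1 (q i).2 c hc
    refine ⟨fun i x hx => ?_, fun i x hx => ?_⟩
    · rw [hUmem, ← mul_apply_eq_comp, ← (h i).1, mul_apply_eq_comp, (hUmem i x).1 hx]
    · rw [hUmem, ← mul_apply_eq_comp, ← (h i).2, mul_apply_eq_comp, (hUmem i x).1 hx]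
  have hVmem : ∀ i, (V i).starProjection ∈ StarSubalgebra.centralizer ℂ S := by
    intro i
    rw [StarSubalgebra.mem_centralizer_iff]
    intro c hc
    obtain ⟨h1, h2⟩ := hcS c hc
    have h1' : ∀ i, ∀ x ∈ U i, star (star c) x ∈ U i := by rw [star_star]; exact h1
    exact ⟨commute_starProjection (hinv c h1 h2 i) (hinv _ h2 h1' i),
      commute_starProjection (hinv _ h2 h1' i) (by rw [star_star]; exact hinv c h1 h2 i)⟩
  let K := PiLp 2 fun i => V i
  let A : Fin n → K →L[ℂ] H := fun i => (V i).subtypeL ∘L PiLp.proj 2 (fun i => V i) i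
  have hAapp : ∀ i (x : K), A i x = (x i : H) := fun i x => rfl
  have hAadj : ∀ i x, adjoint (A i) x = PiLp.single 2 i ((V i).orthogonalProjectionOnto x) := by
    intro i x
    refine ext_inner_right ℂ fun v => ?_
    rw [adjoint_inner_left, hAapp, PiLp.inner_apply, Finset.sum_eq_single i]
    · rw [PiLp.single_eq_same, Submodule.inner_orthogonalProjectionOnto_eq_of_mem_right]
    · intro j _ hj
      rw [PiLp.single_eq_of_ne _ hj, inner_zero_left]
    · simp
  obtain ⟨W, y, hy, hW, h1, h2, h3, h4⟩ := row_polar_of_injective S (A := A)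
    (q := fun i => (V i).starProjection) (fun i j => by
      ext x
      rw [comp_apply, hAapp, hAadj]
      split_ifs with h
      · subst h; rw [PiLp.single_eq_same]; rfl
      · rw [PiLp.single_eq_of_ne _ h]; rfl)
    (by
      ext x i
      rw [sum_apply, one_apply_eq_self]
      simp only [comp_apply, hAadj, hAapp, Submodule.orthogonalProjectionOnto_mem_subspace_eq_self]
      have : (∑ j, PiLp.single 2 j (x j) : K) = x := by
        ext i
        rw [WithLp.ofLp_sum, Finset.sum_apply, Finset.sum_eq_single i, PiLp.single_eq_same]
        · exact fun j _ hj => PiLp.single_eq_of_ne' 2 hj _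
        · simp
      rw [this])
    (by
      rw [injective_iff_map_eq_zero]
      intro x hx
      rw [sum_apply] at hx
      have := hind (fun i => (x i : H)) (fun i => (x i).2) hx
      ext i
      exact congrFun this i) hVmem
  refine ⟨fun i => ⟨_, hVmem i⟩, fun i => ⟨W i, hW i⟩, ⟨y, hy⟩, ?_, ?_, ?_, ?_, ?_, ?_, ?_⟩
  · intro i
    exact ⟨Subtype.ext isStarProjection_starProjection.isIdempotentElem.eq,
      Subtype.ext isStarProjection_starProjection.isSelfAdjoint.star_eq⟩
  · intro i
    apply Subtype.ext
    have h : (q i : H →L[ℂ] H) * (V i).starProjection = (V i).starProjection := by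
      ext x
      exact (hUmem i _).1 (hVU i ((V i).starProjection_apply_mem x))
    have := congrArg star h
    rwa [star_mul, (hqp i).isSelfAdjoint.star_eq,
      (isStarProjection_starProjection (U := V i)).isSelfAdjoint.star_eq] at this
  · intro i j
    apply Subtype.ext
    refine (h1 i j).trans ?_
    split_ifs <;> rfl
  · exact fun i => Subtype.ext (h2 i)
  · exact fun i => Subtype.ext (h3 i)
  · apply Subtype.ext
    simpa using h4
  · intro j
    apply Subtype.ext
    have hJ : ∀ x ∈ U j, (∑ i, W i * star (W i)) x = x := by
      intro x hx
      have hle : (⨆ i, V i).topologicalClosure ≤ LinearMap.ker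
          ((1 - ∑ i, W i * star (W i) : H →L[ℂ] H) : H →ₗ[ℂ] H) := by
        refine Submodule.topologicalClosure_minimal _ (iSup_le fun i v hv => ?_)
          (1 - ∑ i, W i * star (W i)).isClosed_ker
        have h : (∑ i, W i * star (W i)) * (V i).starProjection = (V i).starProjection := by
          have := congrArg star h4
          simp only [star_mul, star_star, star_sum] at this
          rw [← h2 i, ← mul_assoc, this]
        rw [LinearMap.mem_ker]
        change v - (∑ i, W i * star (W i)) v = 0
        rw [sub_eq_zero]
        conv_lhs => rw [← Submodule.starProjection_eq_self_iff.2 hv, ← h]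
        rw [mul_apply_eq_comp, Submodule.starProjection_eq_self_iff.2 hv]
      exact (sub_eq_zero.1 (hle (hUV j hx))).symm
    have : (∑ i, W i * star (W i)) * (q j : H →L[ℂ] H) = q j := by
      ext x
      exact hJ _ (hqU j x)
    simpa using this

end Hilbert

namespace TracialState

section GNS

universe u

open UniformSpace Completion ContinuousLinearMap
open scoped InnerProductSpace

variable {A : Type u} [Ring A] [StarRing A] [Algebra ℂ A] [StarModule ℂ A] (τ : TracialState A)

set_option linter.unusedVariables false in
/-- The algebra `A`, regarded as a pre-Hilbert space with `⟪a, b⟫ = τ (a* b)`. -/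
def PreGNS (τ : TracialState A) : Type _ := A

instance : AddCommGroup τ.PreGNS := inferInstanceAs (AddCommGroup A)

instance : Module ℂ τ.PreGNS := inferInstanceAs (Module ℂ A)

/-- The identity map `A → PreGNS`. -/
def toPre : A ≃ₗ[ℂ] τ.PreGNS := LinearEquiv.refl ℂ _

/-- The semi-inner product `τ (a* b)`. -/
noncomputable abbrev preCore : PreInnerProductSpace.Core ℂ τ.PreGNS where
  inner a b := τ.toLinearMap (star (τ.toPre.symm a) * τ.toPre.symm b)
  conj_inner_symm a b := by
    rw [starRingEnd_apply, ← τ.map_star, star_mul, star_star]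
  re_inner_nonneg a := (Complex.le_def.1 (τ.nonneg _)).1
  add_left a b c := by rw [map_add, star_add, add_mul, map_add]
  smul_left a b r := by simp

noncomputable instance : SeminormedAddCommGroup τ.PreGNS :=
  InnerProductSpace.Core.toSeminormedAddCommGroup (c := τ.preCore)

noncomputable instance : InnerProductSpace ℂ τ.PreGNS := InnerProductSpace.ofCore τ.preCore

theorem inner_toPre (a b : A) : ⟪τ.toPre a, τ.toPre b⟫_ℂ = τ.toLinearMap (star a * b) := rfl

theorem norm_toPre (a : A) : ‖τ.toPre a‖ = √(τ.sq a) := rfl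

/-- The GNS Hilbert space. -/
abbrev GNS := Completion τ.PreGNS

/-- The vector of the GNS space that is given by `a ∈ A`. -/
noncomputable def vec (a : A) : τ.GNS := ((τ.toPre a : τ.PreGNS) : Completion τ.PreGNS)

theorem inner_vec (a b : A) : ⟪τ.vec a, τ.vec b⟫_ℂ = τ.toLinearMap (star a * b) := by
  rw [vec, vec, Completion.inner_coe, inner_toPre]

theorem vec_add (a b : A) : τ.vec (a + b) = τ.vec a + τ.vec b := by
  rw [vec, map_add, Completion.coe_add]; rfl

theorem vec_smul (r : ℂ) (a : A) : τ.vec (r • a) = r • τ.vec a := by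
  rw [vec, map_smul, Completion.coe_smul]; rfl

theorem vec_induction {p : τ.GNS → Prop} (hp : IsClosed {x | p x}) (h : ∀ a, p (τ.vec a))
    (x : τ.GNS) : p x :=
  Completion.induction_on x hp h

theorem vec_induction₂ {p : τ.GNS → τ.GNS → Prop} (hp : IsClosed {x : τ.GNS × τ.GNS | p x.1 x.2})
    (h : ∀ a b, p (τ.vec a) (τ.vec b)) (x y : τ.GNS) : p x y :=
  Completion.induction_on₂ x y hp h

/-- A linear map on `A` that is bounded for the trace norm extends to the GNS space. -/
theorem exists_extension (f : A →ₗ[ℂ] A) {C : ℝ} (hf : ∀ a, τ.sq (f a) ≤ C * τ.sq a) :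
    ∃ T : τ.GNS →L[ℂ] τ.GNS, ∀ a, T (τ.vec a) = τ.vec (f a) := by
  let g : τ.PreGNS →ₗ[ℂ] τ.PreGNS := τ.toPre.toLinearMap ∘ₗ f ∘ₗ τ.toPre.symm.toLinearMap
  refine ⟨(g.mkContinuous √C fun a => ?_).completion, fun a => ?_⟩
  · have h := Real.sqrt_le_sqrt (hf (τ.toPre.symm a))
    rwa [Real.sqrt_mul' _ (τ.sq_nonneg _)] at h
  · rw [vec, ContinuousLinearMap.completion_apply_coe]; rfl

theorem ext_vec {S T : τ.GNS →L[ℂ] τ.GNS} (h : ∀ a, S (τ.vec a) = T (τ.vec a)) : S = T := by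
  ext x
  exact τ.vec_induction (p := fun x => S x = T x) (isClosed_eq S.continuous T.continuous) h x

theorem exists_conjugation : ∃ J : τ.GNS → τ.GNS, (∀ a, J (τ.vec a) = τ.vec (star a)) ∧
    (∀ u v, ⟪J u, v⟫_ℂ = ⟪J v, u⟫_ℂ) ∧ ∀ u v, ⟪J u, J v⟫_ℂ = ⟪v, u⟫_ℂ := by
  let f : τ.PreGNS → τ.PreGNS := fun a => τ.toPre (star (τ.toPre.symm a))
  have hf : UniformContinuous f := by
    refine (Isometry.of_dist_eq fun a b => ?_).uniformContinuous
    rw [dist_eq_norm, dist_eq_norm]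
    change ‖τ.toPre (star (τ.toPre.symm a) - star (τ.toPre.symm b))‖
      = ‖τ.toPre (τ.toPre.symm a - τ.toPre.symm b)‖
    rw [norm_toPre, norm_toPre, ← star_sub, sq_star]
  have hJ : ∀ a, Completion.map f (τ.vec a) = τ.vec (star a) := fun a => Completion.map_coe hf _
  have hc : Continuous (Completion.map f) := Completion.continuous_map
  refine ⟨Completion.map f, hJ, fun u v => ?_, fun u v => ?_⟩
  · refine τ.vec_induction₂ (p := fun u v => ⟪Completion.map f u, v⟫_ℂ = ⟪Completion.map f v, u⟫_ℂ)
      (isClosed_eq (by fun_prop) (by fun_prop)) (fun a b => ?_) u v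
    rw [hJ, hJ, inner_vec, inner_vec, star_star, star_star, τ.tracial]
  · refine τ.vec_induction₂ (p := fun u v => ⟪Completion.map f u, Completion.map f v⟫_ℂ = ⟪v, u⟫_ℂ)
      (isClosed_eq (by fun_prop) (by fun_prop)) (fun a b => ?_) u v
    rw [hJ, hJ, inner_vec, inner_vec, star_star, τ.tracial]

/-- The vector state of `1` on an algebra of operators on the GNS space is tracial if the algebra
commutes with the right multiplications. -/
theorem gns_tracial (r : A → τ.GNS →L[ℂ] τ.GNS) (hr : ∀ a b, r a (τ.vec b) = τ.vec (b * a))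
    {x y : τ.GNS →L[ℂ] τ.GNS} (hx' : ∀ a, r a * star x = star x * r a)
    (hy : ∀ a, r a * y = y * r a) :
    ⟪τ.vec 1, (x * y) (τ.vec 1)⟫_ℂ = ⟪τ.vec 1, (y * x) (τ.vec 1)⟫_ℂ := by
  obtain ⟨J, hJ, hJ1, hJ2⟩ := τ.exists_conjugation
  have hr1 : ∀ a, r a (τ.vec 1) = τ.vec a := fun a => by rw [hr, one_mul]
  have hradj : ∀ a u v, ⟪r a u, v⟫_ℂ = ⟪u, r (star a) v⟫_ℂ := by
    intro a u v
    refine τ.vec_induction₂ (p := fun u v => ⟪r a u, v⟫_ℂ = ⟪u, r (star a) v⟫_ℂ)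
      (isClosed_eq (by fun_prop) (by fun_prop)) (fun b c => ?_) u v
    rw [hr, hr, inner_vec, inner_vec, star_mul, mul_assoc, τ.tracial, mul_assoc]
  have hcomm : ∀ {x : τ.GNS →L[ℂ] τ.GNS}, (∀ a, r a * x = x * r a) → ∀ a u, r a (x u) = x (r a u) :=
    fun h a u => congrArg (fun T : τ.GNS →L[ℂ] τ.GNS => T u) (h a)
  have hJx : ∀ {x : τ.GNS →L[ℂ] τ.GNS}, (∀ a, r a * x = x * r a) →
      J (x (τ.vec 1)) = star x (τ.vec 1) := by
    intro x hx
    refine ext_inner_right ℂ fun v => ?_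
    refine τ.vec_induction (p := fun v => ⟪J (x (τ.vec 1)), v⟫_ℂ = ⟪star x (τ.vec 1), v⟫_ℂ)
      (isClosed_eq (by fun_prop) (by fun_prop)) (fun a => ?_) v
    rw [hJ1, hJ, ← hr1, hradj, star_star, hcomm hx, hr1, star_eq_adjoint, adjoint_inner_left]
  have hx1 := hJx hx'
  rw [star_star] at hx1
  have h : ∀ x y : τ.GNS →L[ℂ] τ.GNS, ⟪τ.vec 1, (x * y) (τ.vec 1)⟫_ℂ
      = ⟪star x (τ.vec 1), y (τ.vec 1)⟫_ℂ := fun x y => by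
    rw [mul_apply_eq_comp, star_eq_adjoint, adjoint_inner_left]
  rw [h, h, ← hJx hy, ← hx1, hJ2]

/-- A tracial state all of whose left multiplications are bounded extends to the von Neumann
algebra that it generates. -/
theorem exists_vonNeumann_extension (hb : ∀ a, ∃ C : ℝ, ∀ b, τ.sq (a * b) ≤ C * τ.sq b) :
    ∃ (N : Type u) (_ : Ring N) (_ : StarRing N) (_ : Algebra ℂ N) (_ : StarModule ℂ N)
      (τN : TracialState N) (π : A →⋆ₐ[ℂ] N),
      (∀ a, τN.toLinearMap (π a) = τ.toLinearMap a) ∧ HasSpectralCuts N ∧ HasRowPolar N := by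
  choose C hC using hb
  choose l hl using fun a => τ.exists_extension (LinearMap.mulLeft ℂ a) (hC a)
  choose r hr using fun a => τ.exists_extension (LinearMap.mulRight ℂ a) (C := C (star a))
    (fun b => by
      rw [LinearMap.mulRight_apply, ← sq_star, star_mul, ← τ.sq_star b]
      exact hC _ _)
  simp only [LinearMap.mulLeft_apply] at hl
  simp only [LinearMap.mulRight_apply] at hr
  have hlstar : ∀ a, l (star a) = star (l a) := fun a => by
    rw [star_eq_adjoint, eq_adjoint_iff]
    intro u v
    refine τ.vec_induction₂ (p := fun u v => ⟪l (star a) u, v⟫_ℂ = ⟪u, l a v⟫_ℂ)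
      (isClosed_eq (by fun_prop) (by fun_prop)) (fun b c => ?_) u v
    rw [hl, hl, inner_vec, inner_vec, star_mul, star_star, mul_assoc]
  have hlr : ∀ a b, l a * r b = r b * l a := fun a b => τ.ext_vec fun c => by
    rw [mul_apply_eq_comp, mul_apply_eq_comp, hr, hl, hl, hr, mul_assoc]
  set S : Set (τ.GNS →L[ℂ] τ.GNS) :=
    (StarSubalgebra.centralizer ℂ (Set.range l) : Set (τ.GNS →L[ℂ] τ.GNS)) with hS
  have hrS : ∀ a, r a ∈ S := fun a => by
    rw [hS, SetLike.mem_coe, StarSubalgebra.mem_centralizer_iff]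
    rintro _ ⟨b, rfl⟩
    exact ⟨hlr b a, by rw [← hlstar]; exact hlr _ a⟩
  have hlmem : ∀ a, l a ∈ StarSubalgebra.centralizer ℂ S := fun a => by
    rw [StarSubalgebra.mem_centralizer_iff]
    intro c hc
    have h := ((StarSubalgebra.mem_centralizer_iff ℂ).1 hc) _ ⟨a, rfl⟩
    refine ⟨h.1.symm, ?_⟩
    have := congrArg star h.2
    rwa [star_mul, star_mul, star_star] at this
  have hcomm : ∀ x : StarSubalgebra.centralizer ℂ S, ∀ a, r a * (x : τ.GNS →L[ℂ] τ.GNS) = x * r a :=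
    fun x a => ((StarSubalgebra.mem_centralizer_iff ℂ).1 x.2 _ (hrS a)).1
  let τN : TracialState (StarSubalgebra.centralizer ℂ S) :=
    { toLinearMap :=
        { toFun := fun x => ⟪τ.vec 1, (x : τ.GNS →L[ℂ] τ.GNS) (τ.vec 1)⟫_ℂ
          map_add' := fun x y => inner_add_right _ _ _
          map_smul' := fun c x => inner_smul_right _ _ _ }
      map_one := by
        change ⟪τ.vec 1, τ.vec 1⟫_ℂ = 1
        rw [inner_vec, star_one, one_mul, τ.map_one]
      map_star := fun x => by
        change ⟪τ.vec 1, star (x : τ.GNS →L[ℂ] τ.GNS) (τ.vec 1)⟫_ℂ = star ⟪τ.vec 1, _⟫_ℂ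
        rw [star_eq_adjoint, adjoint_inner_right, ← inner_conj_symm]; rfl
      nonneg := fun x => by
        change 0 ≤ ⟪τ.vec 1, star (x : τ.GNS →L[ℂ] τ.GNS) ((x : τ.GNS →L[ℂ] τ.GNS) (τ.vec 1))⟫_ℂ
        rw [star_eq_adjoint, adjoint_inner_right, inner_self_eq_norm_sq_to_K,
          ← RCLike.ofReal_pow]
        exact RCLike.ofReal_nonneg.2 (_root_.sq_nonneg _)
      tracial := fun x y =>
        τ.gns_tracial r hr (hcomm (star x)) (hcomm y) }
  let π : A →⋆ₐ[ℂ] StarSubalgebra.centralizer ℂ S :=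
    { toFun := fun a => ⟨l a, hlmem a⟩
      map_one' := Subtype.ext (τ.ext_vec fun b => by
        change l 1 (τ.vec b) = τ.vec b
        rw [hl, one_mul])
      map_mul' := fun a b => Subtype.ext (τ.ext_vec fun c => by
        change l (a * b) (τ.vec c) = l a (l b (τ.vec c))
        rw [hl, hl, hl, mul_assoc])
      map_zero' := Subtype.ext (τ.ext_vec fun b => by
        change l 0 (τ.vec b) = 0
        rw [hl, zero_mul, ← zero_smul ℂ (0 : A), vec_smul, zero_smul])
      map_add' := fun a b => Subtype.ext (τ.ext_vec fun c => by
        change l (a + b) (τ.vec c) = l a (τ.vec c) + l b (τ.vec c)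
        rw [hl, hl, hl, add_mul, vec_add])
      commutes' := fun c => Subtype.ext (τ.ext_vec fun b => by
        change l (algebraMap ℂ A c) (τ.vec b) = c • τ.vec b
        rw [hl, ← Algebra.smul_def, vec_smul])
      map_star' := fun a => Subtype.ext (hlstar a) }
  refine ⟨StarSubalgebra.centralizer ℂ S, inferInstance, inferInstance, inferInstance,
    inferInstance, τN, π, fun a => ?_, hasSpectralCuts_centralizer S, hasRowPolar_centralizer S⟩
  change ⟪τ.vec 1, l a (τ.vec 1)⟫_ℂ = _
  rw [hl, inner_vec, star_one, one_mul, mul_one]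

end GNS

end TracialState

namespace IsPVM

variable {N : Type*} [Ring N] [StarRing N] {Φ : Type*} [Fintype Φ] {P : Φ → N}

theorem star_mul_self (h : IsPVM P) (i : Φ) : star (P i) * P i = P i := by
  rw [(h.proj i).isSelfAdjoint.star_eq, (h.proj i).isIdempotentElem.eq]

theorem sum_star_mul_self (h : IsPVM P) : ∑ i, star (P i) * P i = 1 := by
  simp only [h.star_mul_self, h.sum_eq_one]

theorem mul_eq_ite [DecidableEq Φ] (h : IsPVM P) (i j : Φ) :
    P i * P j = if i = j then P i else 0 := by
  split_ifs with hij
  · rw [← hij, (h.proj i).isIdempotentElem.eq]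
  · exact h.orth i j hij

/-- The image of a projection-valued measure under a map of the index set. -/
theorem map {Ψ : Type*} [Fintype Ψ] [DecidableEq Ψ] (h : IsPVM P) (r : Φ → Ψ) :
    IsPVM fun ψ => ∑ φ with r φ = ψ, P φ where
  proj ψ := isStarProjection_sum _ h.proj h.orth
  orth ψ₁ ψ₂ hne := by
    rw [Finset.sum_mul_sum]
    refine Finset.sum_eq_zero fun i hi => Finset.sum_eq_zero fun j hj => h.orth i j ?_
    rintro rfl
    exact hne ((Finset.mem_filter.1 hi).2.symm.trans (Finset.mem_filter.1 hj).2)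
  sum_eq_one := by rw [Finset.sum_fiberwise, h.sum_eq_one]

theorem comp_equiv {Ψ : Type*} [Fintype Ψ] (h : IsPVM P) (f : Ψ ≃ Φ) :
    IsPVM fun ψ => P (f ψ) where
  proj ψ := h.proj _
  orth _ _ hne := h.orth _ _ (f.injective.ne hne)
  sum_eq_one := by rw [f.sum_comp, h.sum_eq_one]

variable {e : ZMod 2 → N}

theorem add_eq_one (h : IsPVM e) (a : ZMod 2) : e a + e (a + 1) = 1 := by
  have h2 : ∑ i, e i = e 0 + e 1 := Fin.sum_univ_two _
  rw [← h.sum_eq_one, h2]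
  fin_cases a
  · rfl
  · exact add_comm _ _

theorem apply_add_one (h : IsPVM e) (a : ZMod 2) : e (a + 1) = 1 - e a := by
  rw [← h.add_eq_one a, add_sub_cancel_left]

end IsPVM

theorem ZMod.two_eq_or_eq_add_one (a b : ZMod 2) : a = b ∨ a = b + 1 := by
  revert a b; decide

theorem ZMod.two_ne_add_one (a : ZMod 2) : a ≠ a + 1 := by
  revert a; decide

namespace TracialState

section TwoOutcome

variable {N : Type*} [Ring N] [StarRing N] [Algebra ℂ N] (τ : TracialState N)

theorem sq_sub_eq_of_isPVM {e f : ZMod 2 → N} (he : IsPVM e) (hf : IsPVM f) (a b : ZMod 2) :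
    τ.sq (e a - f a) = τ.sq (e b - f b) := by
  rcases ZMod.two_eq_or_eq_add_one a b with rfl | rfl
  · rfl
  · rw [he.apply_add_one, hf.apply_add_one, ← τ.sq_neg]
    congr 1; abel

theorem sq_sub_mul_eq_of_isPVM {e f : ZMod 2 → N} (he : IsPVM e) (hf : IsPVM f) (a b : ZMod 2)
    (z : N) : τ.sq ((e a - f a) * z) = τ.sq ((e b - f b) * z) := by
  rcases ZMod.two_eq_or_eq_add_one a b with rfl | rfl
  · rfl
  · rw [he.apply_add_one, hf.apply_add_one, ← τ.sq_neg]
    congr 1; noncomm_ring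

theorem commutator_mul_sq_eq_of_isPVM {e : ZMod 2 → N} (he : IsPVM e) (a b : ZMod 2) (x z : N) :
    τ.sq ((e a * x - x * e a) * z) = τ.sq ((e b * x - x * e b) * z) := by
  rcases ZMod.two_eq_or_eq_add_one a b with rfl | rfl
  · rfl
  · rw [he.apply_add_one, ← τ.sq_neg]
    congr 1; noncomm_ring

/-- The distance of two binary measurements is the probability that they disagree. -/
theorem sq_sub_eq_disagreement {e f : ZMod 2 → N} (he : IsPVM e) (hf : IsPVM f) :
    τ.sq (e 0 - f 0) = ∑ a, τ.reTr (e (a + 1) * f a) := by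
  have h1 : ∀ a, τ.reTr (e (a + 1) * f a) = τ.reTr (f a) - τ.reTr (e a * f a) := fun a => by
    rw [he.apply_add_one, sub_mul, one_mul, reTr_sub]
  have h2 : τ.reTr (e 1 * f 1) = 1 - τ.reTr (e 0) - τ.reTr (f 0) + τ.reTr (e 0 * f 0) := by
    have e1 : e 1 = 1 - e 0 := he.apply_add_one 0
    have f1 : f 1 = 1 - f 0 := hf.apply_add_one 0
    rw [e1, f1]
    simp only [mul_sub, sub_mul, one_mul, mul_one, reTr_sub, reTr_one]; ring
  have h3 : τ.reTr (f 1) = 1 - τ.reTr (f 0) := by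
    have f1 : f 1 = 1 - f 0 := hf.apply_add_one 0
    rw [f1, reTr_sub, reTr_one]
  have h4 : ∑ a, τ.reTr (e (a + 1) * f a)
      = τ.reTr (e (0 + 1) * f 0) + τ.reTr (e (1 + 1) * f 1) := Fin.sum_univ_two _
  rw [h4, h1, h1, h2, h3, sq_sub, (he.proj 0).isSelfAdjoint.star_eq,
    τ.sq_of_isStarProjection (he.proj 0), τ.sq_of_isStarProjection (hf.proj 0)]
  ring

theorem sum_sq_mul_pvm_le {Φ : Type*} [Fintype Φ] {P : Φ → N} (h : IsPVM P) (z : N) :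
    ∑ i, τ.sq (z * P i) ≤ τ.sq z := by
  have := τ.sum_sq_mul_povm_le h.sum_star_mul_self z
  simpa only [h.star_mul_self] using this

theorem sum_sq_pvm_mul {Φ : Type*} [Fintype Φ] {P : Φ → N} (h : IsPVM P) (z : N) :
    ∑ i, τ.sq (P i * z) = τ.sq z := τ.sum_sq_mul_left h.sum_star_mul_self z

end TwoOutcome

section Sandwich

variable {N : Type*} [Ring N] [StarRing N]

/-- The ordered product `e_{k-1}^{φ_{k-1}} ⋯ e_0^{φ_0}`. -/
def orderedProd : ∀ {k : ℕ}, (Fin k → ZMod 2 → N) → (Fin k → ZMod 2) → N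
  | 0, _, _ => 1
  | _ + 1, e, φ => orderedProd (fun i => e i.succ) (fun i => φ i.succ) * e 0 (φ 0)

/-- The positive element `e_0^{φ_0} ⋯ e_{k-1}^{φ_{k-1}} ⋯ e_0^{φ_0}`. -/
def sandwich {k : ℕ} (e : Fin k → ZMod 2 → N) (φ : Fin k → ZMod 2) : N :=
  star (orderedProd e φ) * orderedProd e φ

theorem sandwich_cons {k : ℕ} {e : Fin (k + 1) → ZMod 2 → N} (he : IsPVM (e 0)) (a : ZMod 2)
    (φ : Fin k → ZMod 2) :
    sandwich e (Fin.cons a φ) = e 0 a * sandwich (fun i => e i.succ) φ * e 0 a := by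
  simp only [sandwich, orderedProd, Fin.cons_zero, Fin.cons_succ, star_mul,
    (he.proj a).isSelfAdjoint.star_eq, mul_assoc]

theorem star_sandwich {k : ℕ} (e : Fin k → ZMod 2 → N) (φ : Fin k → ZMod 2) :
    star (sandwich e φ) = sandwich e φ := by
  rw [sandwich, star_mul, star_star]

theorem sum_fin_succ_arrow {M : Type*} [AddCommMonoid M] {k : ℕ} {α : Type*} [Fintype α]
    (f : (Fin (k + 1) → α) → M) : ∑ φ, f φ = ∑ a, ∑ φ : Fin k → α, f (Fin.cons a φ) := by
  rw [← (Fin.consEquiv fun _ => α).sum_comp, Fintype.sum_prod_type]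
  rfl

theorem sum_sandwich {k : ℕ} {e : Fin k → ZMod 2 → N} (he : ∀ i, IsPVM (e i)) :
    ∑ φ, sandwich e φ = 1 := by
  induction k with
  | zero => simp [sandwich, orderedProd]
  | succ k ih =>
    rw [sum_fin_succ_arrow]
    simp only [sandwich_cons (he 0), ← Finset.sum_mul, ← Finset.mul_sum]
    rw [ih (fun i => he i.succ)]
    simp only [mul_one, ((he 0).proj _).isIdempotentElem.eq, (he 0).sum_eq_one]

variable [Algebra ℂ N] (τ : TracialState N)

theorem sum_sq_mul_sandwich_le {k : ℕ} {e : Fin k → ZMod 2 → N} (he : ∀ i, IsPVM (e i)) (z : N) :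
    ∑ φ, τ.sq (z * sandwich e φ) ≤ τ.sq z :=
  τ.sum_sq_mul_povm_le (G := orderedProd e) (sum_sandwich he) z

theorem sum_sq_conj_le {e : ZMod 2 → N} (he : IsPVM e) (z : N) :
    ∑ a, τ.sq (e a * z * e a) ≤ τ.sq z := by
  rw [← τ.sum_sq_pvm_mul he z]
  exact Finset.sum_le_sum fun a _ => τ.sq_mul_projection_le (he.proj a) _

variable [StarModule ℂ N]

theorem sum_sq_commutator_sandwich_le {k : ℕ} {e : Fin k → ZMod 2 → N} (he : ∀ i, IsPVM (e i))
    (x : N) {s : ℝ} (hs : 0 ≤ s) (hx : ∀ i, ∑ b, τ.sq (x * e i b - e i b * x) ≤ s ^ 2) :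
    ∑ φ, τ.sq (x * sandwich e φ - sandwich e φ * x) ≤ (2 * k * s) ^ 2 := by
  induction k with
  | zero => simp [sandwich, orderedProd, sq_zero]
  | succ k ih =>
    specialize ih (fun i => he i.succ) (fun i => hx i.succ)
    set F := sandwich (fun i => e i.succ) with hF
    have hsplit : ∀ p : ZMod 2 × (Fin k → ZMod 2),
        x * sandwich e (Fin.cons p.1 p.2) - sandwich e (Fin.cons p.1 p.2) * x
        = ((x * e 0 p.1 - e 0 p.1 * x) * F p.2 * e 0 p.1
          + e 0 p.1 * (x * F p.2 - F p.2 * x) * e 0 p.1)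
          + e 0 p.1 * F p.2 * (x * e 0 p.1 - e 0 p.1 * x) := fun p => by
      rw [sandwich_cons (he 0)]; noncomm_ring
    have h1 : ∑ p : ZMod 2 × (Fin k → ZMod 2),
        τ.sq ((x * e 0 p.1 - e 0 p.1 * x) * F p.2 * e 0 p.1) ≤ s ^ 2 := by
      rw [Fintype.sum_prod_type]
      refine (Finset.sum_le_sum fun b _ => ?_).trans (hx 0)
      refine (Finset.sum_le_sum fun φ _ => τ.sq_mul_projection_le ((he 0).proj b) _).trans ?_
      exact τ.sum_sq_mul_sandwich_le (fun i => he i.succ) (x * e 0 b - e 0 b * x)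
    have h2 : ∑ p : ZMod 2 × (Fin k → ZMod 2),
        τ.sq (e 0 p.1 * (x * F p.2 - F p.2 * x) * e 0 p.1) ≤ (2 * k * s) ^ 2 := by
      rw [Fintype.sum_prod_type_right]
      exact (Finset.sum_le_sum fun φ _ => τ.sum_sq_conj_le (he 0) _).trans ih
    have h3 : ∑ p : ZMod 2 × (Fin k → ZMod 2),
        τ.sq (e 0 p.1 * F p.2 * (x * e 0 p.1 - e 0 p.1 * x)) ≤ s ^ 2 := by
      rw [Fintype.sum_prod_type]
      refine (Finset.sum_le_sum fun b _ => ?_).trans (hx 0)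
      have : ∀ φ, τ.sq (e 0 b * F φ * (x * e 0 b - e 0 b * x))
          ≤ τ.sq (star (x * e 0 b - e 0 b * x) * F φ) := fun φ => by
        rw [mul_assoc, ← τ.sq_star (star _ * _), star_mul, star_star, star_sandwich]
        exact τ.sq_projection_mul_le ((he 0).proj b) _
      refine (Finset.sum_le_sum fun φ _ => this φ).trans ?_
      rw [← τ.sq_star (x * e 0 b - e 0 b * x)]
      exact τ.sum_sq_mul_sandwich_le (fun i => he i.succ) _
    have h12 := τ.sum_sq_add_le _ _ _ hs (by positivity) h1 h2
    have h123 := τ.sum_sq_add_le _ _ _ (by positivity) hs h12 h3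
    rw [sum_fin_succ_arrow,
      ← Fintype.sum_prod_type' fun a φ => τ.sq (x * sandwich e (Fin.cons a φ)
        - sandwich e (Fin.cons a φ) * x)]
    simp only [hsplit]
    refine h123.trans (le_of_eq ?_)
    push_cast; ring

theorem sum_reTr_sandwich_sub_sq_le {k : ℕ} {e : Fin k → ZMod 2 → N} (he : ∀ i, IsPVM (e i))
    {s : ℝ} (hs : 0 ≤ s)
    (hx : ∀ i j a, ∑ b, τ.sq (e i a * e j b - e j b * e i a) ≤ s ^ 2) :
    ∑ φ, τ.reTr (sandwich e φ - sandwich e φ * sandwich e φ) ≤ 4 * k ^ 3 * s ^ 2 := by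
  induction k with
  | zero => simp [sandwich, orderedProd, reTr_zero]
  | succ k ih =>
    specialize ih (fun i => he i.succ) (fun i j => hx i.succ j.succ)
    set F := sandwich (fun i => e i.succ) with hF
    have hFs : ∀ φ, star (F φ) = F φ := star_sandwich _
    have hstep : ∀ φ, ∑ a, τ.reTr (e 0 a * F φ * e 0 a - e 0 a * F φ * e 0 a * (e 0 a * F φ * e 0 a))
        = τ.reTr (F φ - F φ * F φ) + (∑ a, τ.sq (e 0 a * F φ - F φ * e 0 a)) / 2 := by
      intro φ
      have hmul : ∀ z : N, ∑ a, τ.reTr (e 0 a * z) = τ.reTr z := fun z => by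
        rw [← reTr_sum, ← Finset.sum_mul, (he 0).sum_eq_one, one_mul]
      have hee : ∀ a z, e 0 a * (e 0 a * z) = e 0 a * z := fun a z => by
        rw [← mul_assoc, ((he 0).proj a).isIdempotentElem.eq]
      have e1 : ∀ a, τ.reTr (e 0 a * F φ * e 0 a) = τ.reTr (e 0 a * F φ) := fun a => by
        rw [reTr_mul_comm, hee]
      have e2 : ∀ a, τ.reTr (e 0 a * F φ * e 0 a * (e 0 a * F φ * e 0 a))
          = τ.reTr (e 0 a * (F φ * e 0 a * F φ)) := fun a => by
        have : e 0 a * F φ * e 0 a * (e 0 a * F φ * e 0 a)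
            = e 0 a * (F φ * (e 0 a * (F φ * e 0 a))) := by
          simp only [mul_assoc, hee]
        rw [this]
        have : e 0 a * (F φ * (e 0 a * (F φ * e 0 a))) = (e 0 a * (F φ * e 0 a * F φ)) * e 0 a := by
          simp only [mul_assoc]
        rw [this, reTr_mul_comm, hee]
      have e3 : ∀ a, τ.sq (e 0 a * F φ - F φ * e 0 a)
          = 2 * τ.reTr (e 0 a * (F φ * F φ)) - 2 * τ.reTr (e 0 a * (F φ * e 0 a * F φ)) := fun a => by
        rw [sq_sub, sq_mul_left, sq_mul_right, hFs, (he 0).star_mul_self,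
          ((he 0).proj a).isSelfAdjoint.star_eq, ((he 0).proj a).isIdempotentElem.eq,
          star_mul, hFs, ((he 0).proj a).isSelfAdjoint.star_eq]
        have t1 : τ.reTr (F φ * e 0 a * F φ) = τ.reTr (e 0 a * (F φ * F φ)) := by
          rw [mul_assoc, reTr_mul_comm, mul_assoc]
        have t2 : τ.reTr (F φ * e 0 a * (F φ * e 0 a)) = τ.reTr (e 0 a * (F φ * e 0 a * F φ)) := by
          rw [← mul_assoc, reTr_mul_comm]
        rw [t1, t2]; ring
      simp only [reTr_sub, e1, e2, e3, Finset.sum_sub_distrib, ← Finset.mul_sum, hmul]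
      ring
    rw [sum_fin_succ_arrow, Finset.sum_comm]
    simp only [sandwich_cons (he 0), ← hF, hstep]
    rw [Finset.sum_add_distrib, ← Finset.sum_div, Finset.sum_comm]
    have hc : ∀ a, ∑ φ, τ.sq (e 0 a * F φ - F φ * e 0 a) ≤ (2 * k * s) ^ 2 := fun a =>
      τ.sum_sq_commutator_sandwich_le (fun i => he i.succ) _ hs fun i => hx 0 i.succ a
    have hc2 : ∑ a, ∑ φ, τ.sq (e 0 a * F φ - F φ * e 0 a) ≤ 2 * (2 * k * s) ^ 2 := by
      refine (Finset.sum_le_sum fun a _ => hc a).trans (le_of_eq ?_)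
      rw [Finset.sum_const, Finset.card_univ, ZMod.card, nsmul_eq_mul]; norm_num
    have : (4 : ℝ) * k ^ 3 * s ^ 2 + (2 * k * s) ^ 2 ≤ 4 * ((k + 1 : ℕ) : ℝ) ^ 3 * s ^ 2 := by
      push_cast
      have : (0 : ℝ) ≤ s ^ 2 * (8 * k ^ 2 + 12 * k + 4) := by positivity
      nlinarith
    linarith

theorem sum_sq_mul_sandwich_disagree_le {k : ℕ} {e : Fin k → ZMod 2 → N} (he : ∀ i, IsPVM (e i))
    {s : ℝ} (hs : 0 ≤ s)
    (hx : ∀ i j a, ∑ b, τ.sq (e i a * e j b - e j b * e i a) ≤ s ^ 2) (i : Fin k) :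
    ∑ φ, τ.sq (e i (φ i + 1) * sandwich e φ) ≤ (k * s) ^ 2 := by
  induction k with
  | zero => exact i.elim0
  | succ k ih =>
    rw [sum_fin_succ_arrow]
    simp only [sandwich_cons (he 0)]
    refine Fin.cases ?_ (fun j => ?_) i
    · have : ∀ a (φ : Fin k → ZMod 2), e 0 ((Fin.cons a φ : Fin (k + 1) → ZMod 2) 0 + 1)
          * (e 0 a * sandwich (fun i => e i.succ) φ * e 0 a) = 0 := fun a φ => by
        rw [Fin.cons_zero, mul_assoc, ← mul_assoc,
          (he 0).orth _ _ (ZMod.two_ne_add_one a).symm, zero_mul]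
      simp only [this, sq_zero, Finset.sum_const_zero]
      positivity
    · specialize ih (fun i => he i.succ) (fun i j => hx i.succ j.succ) j
      set F := sandwich (fun i => e i.succ) with hF
      simp only [Fin.cons_succ]
      have hsplit : ∀ p : ZMod 2 × (Fin k → ZMod 2),
          e j.succ (p.2 j + 1) * (e 0 p.1 * F p.2 * e 0 p.1)
          = (e j.succ (p.2 j + 1) * e 0 p.1 - e 0 p.1 * e j.succ (p.2 j + 1)) * F p.2 * e 0 p.1
            + e 0 p.1 * (e j.succ (p.2 j + 1) * F p.2) * e 0 p.1 := fun p => by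
        noncomm_ring
      have h1 : ∑ p : ZMod 2 × (Fin k → ZMod 2),
          τ.sq ((e j.succ (p.2 j + 1) * e 0 p.1 - e 0 p.1 * e j.succ (p.2 j + 1)) * F p.2 * e 0 p.1)
            ≤ s ^ 2 := by
        rw [Fintype.sum_prod_type]
        refine (Finset.sum_le_sum fun b _ => ?_).trans (hx j.succ 0 0)
        refine (Finset.sum_le_sum fun φ _ => ?_).trans
          (τ.sum_sq_mul_sandwich_le (fun i => he i.succ) _)
        rw [← τ.commutator_mul_sq_eq_of_isPVM (he j.succ) (φ j + 1) 0]
        exact τ.sq_mul_projection_le ((he 0).proj b) _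
      have h2 : ∑ p : ZMod 2 × (Fin k → ZMod 2),
          τ.sq (e 0 p.1 * (e j.succ (p.2 j + 1) * F p.2) * e 0 p.1) ≤ (k * s) ^ 2 := by
        rw [Fintype.sum_prod_type_right]
        exact (Finset.sum_le_sum fun φ _ => τ.sum_sq_conj_le (he 0) _).trans ih
      have h12 := τ.sum_sq_add_le _ _ _ hs (by positivity) h1 h2
      rw [← Fintype.sum_prod_type' fun a φ => τ.sq (e j.succ (φ j + 1) * (e 0 a * F φ * e 0 a))]
      simp only [hsplit]
      refine h12.trans (le_of_eq ?_)
      push_cast; ring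

/-- Binary measurements that nearly commute are close to the marginals of a joint measurement. -/
theorem exists_joint_pvm (hcut : HasSpectralCuts N) (hrow : HasRowPolar N) {V : Type*} [Fintype V]
    [DecidableEq V] {e : V → ZMod 2 → N} (he : ∀ x, IsPVM (e x)) {s : ℝ} (hs : 0 ≤ s)
    (hx : ∀ x y a, ∑ b, τ.sq (e x a * e y b - e y b * e x a) ≤ s ^ 2) :
    ∃ P : (V → ZMod 2) → N, IsPVM P ∧ ∀ x, ∑ φ, τ.sq (e x (φ x + 1) * P φ)
      ≤ (1104 * Fintype.card V ^ 3 + 2 * Fintype.card V ^ 2) * s ^ 2 := by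
  let f := Fintype.equivFin V
  set k := Fintype.card V with hk
  let e' : Fin k → ZMod 2 → N := fun i => e (f.symm i)
  have he' : ∀ i, IsPVM (e' i) := fun i => he _
  have hx' : ∀ i j a, ∑ b, τ.sq (e' i a * e' j b - e' j b * e' i a) ≤ s ^ 2 := fun i j => hx _ _
  obtain ⟨P, hP, hnear⟩ := τ.exists_isPVM_near hcut hrow (G := orderedProd e') (sum_sandwich he')
  have hη := τ.sum_reTr_sandwich_sub_sq_le he' hs hx'
  have hnear' : ∑ φ, τ.sq (P φ - sandwich e' φ) ≤ 138 * (4 * k ^ 3 * s ^ 2) :=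
    hnear.trans (mul_le_mul_of_nonneg_left hη (by norm_num))
  let g : (V → ZMod 2) ≃ (Fin k → ZMod 2) := f.arrowCongr (Equiv.refl _)
  have hg : ∀ φ x, g φ (f x) = φ x := fun φ x => by simp [g]
  refine ⟨fun φ => P (g φ), hP.comp_equiv g, fun x => ?_⟩
  have hrew : ∑ φ, τ.sq (e x (φ x + 1) * P (g φ))
      = ∑ φ, τ.sq (e' (f x) (φ (f x) + 1) * P φ) := by
    rw [← g.sum_comp]
    refine Finset.sum_congr rfl fun φ _ => ?_
    rw [hg]; simp [e']
  rw [hrew]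
  have hd := τ.sum_sq_mul_sandwich_disagree_le he' hs hx' (f x)
  have hterm : ∀ φ, τ.sq (e' (f x) (φ (f x) + 1) * P φ) ≤ 2 * τ.sq (P φ - sandwich e' φ)
      + 2 * τ.sq (e' (f x) (φ (f x) + 1) * sandwich e' φ) := fun φ => by
    have h : e' (f x) (φ (f x) + 1) * P φ = e' (f x) (φ (f x) + 1) * (P φ - sandwich e' φ)
        + e' (f x) (φ (f x) + 1) * sandwich e' φ := by rw [mul_sub, sub_add_cancel]
    rw [h]
    linarith [τ.sq_add_le (e' (f x) (φ (f x) + 1) * (P φ - sandwich e' φ))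
      (e' (f x) (φ (f x) + 1) * sandwich e' φ),
      τ.sq_projection_mul_le ((he' (f x)).proj (φ (f x) + 1)) (P φ - sandwich e' φ)]
  refine (Finset.sum_le_sum fun φ _ => hterm φ).trans ?_
  rw [Finset.sum_add_distrib, ← Finset.mul_sum, ← Finset.mul_sum]
  nlinarith

end Sandwich

end TracialState

section Marginal

variable {N : Type*} [Ring N] [StarRing N] {V : Type*} [Fintype V] [DecidableEq V]
  {P : (V → ZMod 2) → N}

/-- The marginal of a family indexed by assignments at a variable. -/
def marginal (P : (V → ZMod 2) → N) (v : V) (a : ZMod 2) : N := ∑ φ with φ v = a, P φ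

theorem IsPVM.marginal (h : IsPVM P) (v : V) : IsPVM (marginal P v) := h.map fun φ => φ v

theorem IsPVM.marginal_commute (h : IsPVM P) (u v : V) (a b : ZMod 2) :
    _root_.marginal P u a * _root_.marginal P v b
      = _root_.marginal P v b * _root_.marginal P u a := by
  rw [_root_.marginal, _root_.marginal, Finset.sum_mul_sum, Finset.sum_mul_sum, Finset.sum_comm]
  refine Finset.sum_congr rfl fun φ _ => Finset.sum_congr rfl fun ψ _ => ?_
  rcases eq_or_ne φ ψ with rfl | hne
  · rfl
  · rw [h.orth _ _ hne, h.orth _ _ hne.symm]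

end Marginal

namespace TracialState

variable {N : Type*} [Ring N] [StarRing N] [Algebra ℂ N] (τ : TracialState N)

theorem sq_sum_pvm_mul {Φ : Type*} [Fintype Φ] {P : Φ → N} (h : IsPVM P) (s : Finset Φ) (z : N) :
    τ.sq ((∑ i ∈ s, P i) * z) = ∑ i ∈ s, τ.sq (P i * z) := by
  have hp := isStarProjection_sum s h.proj h.orth
  simp only [sq_mul_left, h.star_mul_self, hp.isSelfAdjoint.star_eq, hp.isIdempotentElem.eq]
  rw [Finset.mul_sum, Finset.sum_mul, reTr_sum]

section Marginal

variable {V W : Type*} [Fintype V] [DecidableEq V] [Fintype W] [DecidableEq W]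
  {P : (V → ZMod 2) → N} {Q : (W → ZMod 2) → N}

theorem sq_marginal_mul (h : IsPVM P) (v : V) (a : ZMod 2) (z : N) :
    τ.sq (marginal P v a * z) = ∑ φ with φ v = a, τ.sq (P φ * z) := τ.sq_sum_pvm_mul h _ z

theorem sq_sub_marginal_eq {e : ZMod 2 → N} (he : IsPVM e) (h : IsPVM P) (v : V) :
    τ.sq (e 0 - marginal P v 0) = ∑ φ, τ.reTr (e (φ v + 1) * P φ) := by
  rw [τ.sq_sub_eq_disagreement he (h.marginal v),
    ← Finset.sum_fiberwise Finset.univ (fun φ => φ v) fun φ => τ.reTr (e (φ v + 1) * P φ)]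
  refine Finset.sum_congr rfl fun a _ => ?_
  rw [marginal, Finset.mul_sum, reTr_sum]
  refine Finset.sum_congr rfl fun φ hφ => ?_
  rw [(Finset.mem_filter.1 hφ).2]

theorem sq_marginal_sub_marginal (hP : IsPVM P) (hQ : IsPVM Q) (v : V) (w : W) :
    τ.sq (marginal P v 0 - marginal Q w 0)
      = ∑ φ, ∑ ψ, if φ v = ψ w then 0 else τ.sq (P φ * Q ψ) := by
  rw [τ.sq_sub_marginal_eq (hP.marginal v) hQ, Finset.sum_comm]
  refine Finset.sum_congr rfl fun ψ _ => ?_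
  rw [← τ.sq_mul_projections ((hP.marginal v).proj _) (hQ.proj _), τ.sq_marginal_mul hP,
    Finset.sum_filter]
  refine Finset.sum_congr rfl fun φ _ => ?_
  rcases ZMod.two_eq_or_eq_add_one (φ v) (ψ w) with h | h
  · rw [if_pos h, if_neg]
    rw [h]; exact ZMod.two_ne_add_one _
  · rw [if_pos h, if_neg]
    rw [h]; exact (ZMod.two_ne_add_one _).symm

end Marginal

/-- The loss in rounding the measurements of `n` clauses on `k` variables to a joint measurement
of satisfying assignments. -/
def roundingBound (k n : ℝ) : ℝ :=
  2 * (32 * (1104 * k ^ 3 + 2 * k ^ 2) + n * k * (2 * (32 * (1104 * k ^ 3 + 2 * k ^ 2)) + 2)) + 2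

variable [StarModule ℂ N]

theorem exists_constraint_pvm (hcut : HasSpectralCuts N) (hrow : HasRowPolar N)
    {V ι : Type*} [Fintype V] [DecidableEq V] [Fintype ι] {W : ι → Type*} [∀ j, Fintype (W j)]
    [∀ j, DecidableEq (W j)] (emb : ∀ j, W j → V) (hemb : ∀ j, Function.Injective (emb j))
    (hpair : ∀ x y, ∃ j u v, emb j u = x ∧ emb j v = y)
    {R : ∀ j, (W j → ZMod 2) → N} (hR : ∀ j, IsPVM (R j))
    {C : Finset (V → ZMod 2)} {D : ∀ j, Finset (W j → ZMod 2)}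
    (hD : ∀ j, ∀ ψ ∉ D j, R j ψ = 0) (hC : ∀ φ : V → ZMod 2, (∀ j, φ ∘ emb j ∈ D j) → φ ∈ C)
    (hne : C.Nonempty) {δ : ℝ} (hδ0 : 0 ≤ δ)
    (hδ : ∀ j l u v, emb j u = emb l v → τ.sq (marginal (R j) u 0 - marginal (R l) v 0) ≤ δ) :
    ∃ Q : (V → ZMod 2) → N, IsPVM Q ∧ (∀ φ ∉ C, Q φ = 0) ∧ ∀ j v,
      τ.sq (marginal Q (emb j v) 0 - marginal (R j) v 0)
        ≤ roundingBound (Fintype.card V) (Fintype.card ι) * δ := by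
  classical
  obtain ⟨φ₀, hφ₀⟩ := hne
  have hcov : ∀ x, ∃ j u, emb j u = x := fun x => by
    obtain ⟨j, u, -, hu, -⟩ := hpair x x
    exact ⟨j, u, hu⟩
  choose c w hw using hcov
  set e : V → ZMod 2 → N := fun x => marginal (R (c x)) (w x) with he
  have hepvm : ∀ x, IsPVM (e x) := fun x => (hR _).marginal _
  have hnear : ∀ j v a, τ.sq (e (emb j v) a - marginal (R j) v a) ≤ δ := fun j v a => by
    rw [τ.sq_sub_eq_of_isPVM (hepvm _) ((hR j).marginal v) a 0]
    exact hδ _ _ _ _ (hw _)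
  have hcommute : ∀ x y a b, τ.sq (e x a * e y b - e y b * e x a) ≤ 16 * δ := fun x y a b => by
    obtain ⟨j, u, v, rfl, rfl⟩ := hpair x y
    have hsplit : e (emb j u) a * e (emb j v) b - e (emb j v) b * e (emb j u) a
        = ((e (emb j u) a - marginal (R j) u a) * e (emb j v) b
            - e (emb j v) b * (e (emb j u) a - marginal (R j) u a))
          - ((e (emb j v) b - marginal (R j) v b) * marginal (R j) u a
            - marginal (R j) u a * (e (emb j v) b - marginal (R j) v b)) := by
      simp only [sub_mul, mul_sub, (hR j).marginal_commute v u b a]; abel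
    rw [hsplit]
    have h1 := τ.sq_commutator_le ((hepvm (emb j v)).proj b) (e (emb j u) a - marginal (R j) u a)
    have h2 := τ.sq_commutator_le (((hR j).marginal u).proj a)
      (e (emb j v) b - marginal (R j) v b)
    refine (τ.sq_sub_le _ _).trans ?_
    linarith [hnear j u a, hnear j v b]
  set s := √(32 * δ) with hs
  have hss : s ^ 2 = 32 * δ := Real.sq_sqrt (by positivity)
  obtain ⟨P, hP, hPe⟩ := τ.exists_joint_pvm hcut hrow hepvm (Real.sqrt_nonneg (32 * δ))
    (fun x y a => by
      rw [← hs, hss]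
      refine (Finset.sum_le_sum fun b _ => hcommute x y a b).trans (le_of_eq ?_)
      rw [Finset.sum_const, Finset.card_univ, ZMod.card, nsmul_eq_mul]; push_cast; ring)
  rw [← hs, hss] at hPe
  set k : ℝ := (Fintype.card V : ℝ) with hk
  set n : ℝ := (Fintype.card ι : ℝ) with hn
  set q : ℝ := 32 * (1104 * k ^ 3 + 2 * k ^ 2) with hq
  have hPe' : ∀ x, ∑ φ, τ.sq (e x (φ x + 1) * P φ) ≤ q * δ := fun x =>
    (hPe x).trans (le_of_eq (by rw [hq]; ring))
  -- the probability that the joint measurement violates the constraint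
  have hclause : ∀ j v, ∑ φ, τ.sq (marginal (R j) v (φ (emb j v) + 1) * P φ)
      ≤ (2 * q + 2) * δ := fun j v => by
    have hterm : ∀ φ, τ.sq (marginal (R j) v (φ (emb j v) + 1) * P φ)
        ≤ 2 * τ.sq (e (emb j v) (φ (emb j v) + 1) * P φ)
          + 2 * τ.sq ((e (emb j v) 0 - marginal (R j) v 0) * P φ) := fun φ => by
      rw [← τ.sq_sub_mul_eq_of_isPVM (hepvm _) ((hR j).marginal v) (φ (emb j v) + 1) 0]
      refine le_trans (le_of_eq ?_) (τ.sq_sub_le _ _)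
      congr 1; noncomm_ring
    refine (Finset.sum_le_sum fun φ _ => hterm φ).trans ?_
    rw [Finset.sum_add_distrib, ← Finset.mul_sum, ← Finset.mul_sum]
    have := (τ.sum_sq_mul_pvm_le hP (e (emb j v) 0 - marginal (R j) v 0)).trans (hnear j v 0)
    linarith [hPe' (emb j v)]
  have hbad : ∀ φ ∉ C, τ.reTr (P φ)
      ≤ ∑ j, ∑ v, τ.sq (marginal (R j) v (φ (emb j v) + 1) * P φ) := by
    intro φ hφ
    obtain ⟨j, hj⟩ : ∃ j, φ ∘ emb j ∉ D j := by
      by_contra h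
      push Not at h
      exact hφ (hC φ h)
    refine le_trans ?_ (Finset.single_le_sum (f := fun j =>
      ∑ v, τ.sq (marginal (R j) v (φ (emb j v) + 1) * P φ))
      (fun j _ => Finset.sum_nonneg fun v _ => τ.sq_nonneg _) (Finset.mem_univ j))
    simp only [τ.sq_marginal_mul (hR j), Finset.sum_filter]
    rw [← τ.sq_of_isStarProjection (hP.proj φ), ← τ.sum_sq_pvm_mul (hR j), Finset.sum_comm]
    refine Finset.sum_le_sum fun ψ _ => ?_
    by_cases hψ : ψ ∈ D j
    · have : ψ ≠ φ ∘ emb j := fun h => hj (h ▸ hψ)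
      obtain ⟨v, hv⟩ := Function.ne_iff.1 this
      have hv' : ψ v = φ (emb j v) + 1 :=
        (ZMod.two_eq_or_eq_add_one _ _).resolve_left hv
      refine le_trans ?_ (Finset.single_le_sum (f := fun v =>
        if ψ v = φ (emb j v) + 1 then τ.sq (R j ψ * P φ) else 0)
        (fun v _ => ?_) (Finset.mem_univ v))
      · simp only [if_pos hv']; exact le_rfl
      · split_ifs
        exacts [τ.sq_nonneg _, le_rfl]
    · rw [hD j ψ hψ, zero_mul, sq_zero]
      simp
  have hmass : ∑ φ with φ ∉ C, τ.reTr (P φ) ≤ n * k * (2 * q + 2) * δ := by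
    have hcard : ∀ j, (Fintype.card (W j) : ℝ) ≤ k := fun j => by
      rw [hk]; exact_mod_cast Fintype.card_le_of_injective _ (hemb j)
    have hq0 : 0 ≤ (2 * q + 2) * δ := by positivity
    calc ∑ φ with φ ∉ C, τ.reTr (P φ)
        ≤ ∑ φ with φ ∉ C, ∑ j, ∑ v, τ.sq (marginal (R j) v (φ (emb j v) + 1) * P φ) :=
          Finset.sum_le_sum fun φ hφ => hbad φ (Finset.mem_filter.1 hφ).2
      _ ≤ ∑ φ, ∑ j, ∑ v, τ.sq (marginal (R j) v (φ (emb j v) + 1) * P φ) :=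
          Finset.sum_le_sum_of_subset_of_nonneg (Finset.filter_subset _ _) fun φ _ _ =>
            Finset.sum_nonneg fun j _ => Finset.sum_nonneg fun v _ => τ.sq_nonneg _
      _ = ∑ j, ∑ v, ∑ φ, τ.sq (marginal (R j) v (φ (emb j v) + 1) * P φ) := by
          rw [Finset.sum_comm]
          exact Finset.sum_congr rfl fun j _ => Finset.sum_comm
      _ ≤ ∑ j : ι, k * ((2 * q + 2) * δ) := by
          refine Finset.sum_le_sum fun j _ =>
            (Finset.sum_le_sum fun v _ => hclause j v).trans ?_
          rw [Finset.sum_const, Finset.card_univ, nsmul_eq_mul]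
          exact mul_le_mul_of_nonneg_right (hcard j) hq0
      _ = n * k * (2 * q + 2) * δ := by
          rw [Finset.sum_const, Finset.card_univ, nsmul_eq_mul]; ring
  -- move the mass outside of `C` to `φ₀`
  let r : (V → ZMod 2) → V → ZMod 2 := fun φ => if φ ∈ C then φ else φ₀
  set Q : (V → ZMod 2) → N := fun ψ => ∑ φ with r φ = ψ, P φ with hQdef
  have hQ : IsPVM Q := hP.map r
  have hrC : ∀ φ, r φ ∈ C := fun φ => by
    simp only [r]; split_ifs with h
    exacts [h, hφ₀]
  have hQe : ∀ x, τ.sq (e x 0 - marginal Q x 0) ≤ (q + n * k * (2 * q + 2)) * δ := fun x => by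
    rw [τ.sq_sub_marginal_eq (hepvm x) hQ]
    have hpush : ∑ ψ, τ.reTr (e x (ψ x + 1) * Q ψ) = ∑ φ, τ.reTr (e x (r φ x + 1) * P φ) := by
      rw [← Finset.sum_fiberwise Finset.univ r fun φ => τ.reTr (e x (r φ x + 1) * P φ)]
      refine Finset.sum_congr rfl fun ψ _ => ?_
      rw [hQdef, Finset.mul_sum, reTr_sum]
      refine Finset.sum_congr rfl fun φ hφ => ?_
      rw [(Finset.mem_filter.1 hφ).2]
    have hterm : ∀ φ, τ.reTr (e x (r φ x + 1) * P φ)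
        ≤ τ.sq (e x (φ x + 1) * P φ) + if φ ∉ C then τ.reTr (P φ) else 0 := fun φ => by
      rw [← τ.sq_mul_projections ((hepvm x).proj _) (hP.proj φ)]
      by_cases h : φ ∈ C
      · simp only [r, if_pos h, h, not_true_eq_false, if_false, add_zero, le_refl]
      · rw [if_pos h, ← τ.sq_of_isStarProjection (hP.proj φ)]
        linarith [τ.sq_projection_mul_le ((hepvm x).proj (r φ x + 1)) (P φ),
          τ.sq_nonneg (e x (φ x + 1) * P φ)]
    rw [hpush]
    refine (Finset.sum_le_sum fun φ _ => hterm φ).trans ?_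
    rw [Finset.sum_add_distrib, ← Finset.sum_filter]
    linarith [hPe' x]
  refine ⟨Q, hQ, fun φ hφ => ?_, fun j v => ?_⟩
  · rw [hQdef]
    refine Finset.sum_eq_zero fun ψ hψ => absurd (hrC ψ) ?_
    rwa [(Finset.mem_filter.1 hψ).2]
  · have hsplit : marginal Q (emb j v) 0 - marginal (R j) v 0
        = (marginal Q (emb j v) 0 - e (emb j v) 0) + (e (emb j v) 0 - marginal (R j) v 0) := by
      abel
    rw [hsplit]
    have h1 := hQe (emb j v)
    rw [sq_sub_comm] at h1
    refine (τ.sq_add_le _ _).trans ?_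
    rw [roundingBound, ← hq]
    linarith [hnear j v 0]

end TracialState

theorem neg_one_pow_val_add (a b : ZMod 2) :
    (-1 : ℂ) ^ (a + b).val = (-1) ^ a.val * (-1) ^ b.val := by
  rw [← pow_add, ZMod.val_add, ← neg_one_pow_eq_pow_mod_two]

namespace GroupAlg

variable {V : Type*}

theorem gen_mul_gen (x : V) : gen x * gen x = 1 := by
  classical
  unfold gen
  rw [MonoidAlgebra.single_mul_single, mul_one, MonoidAlgebra.one_def]
  congr 1
  apply Multiplicative.toAdd.injective
  funext y
  exact CharTwo.add_self_eq_zero _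

theorem proj_add_proj (x : V) : proj 0 x + proj 1 x = 1 := by
  simp only [proj, ← smul_add, ZMod.val_zero, ZMod.val_one, pow_zero, pow_one, one_smul, neg_smul]
  rw [show (1 + gen x + (1 + -gen x) : GroupAlg V) = (2 : ℂ) • 1 by rw [two_smul]; abel, smul_smul]
  norm_num

theorem proj_mul_proj (a b : ZMod 2) (x : V) :
    proj a x * proj b x = if a = b then proj a x else 0 := by
  have h : proj 0 x * proj 1 x = 0 := by
    simp only [proj, ZMod.val_zero, ZMod.val_one, pow_zero, pow_one, one_smul, neg_smul,
      smul_mul_smul_comm]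
    rw [show (1 + gen x) * (1 + -gen x) = 1 - gen x * gen x by ring, gen_mul_gen, sub_self,
      smul_zero]
  have h0 : proj 0 x * proj 0 x = proj 0 x := by
    conv_rhs => rw [← mul_one (proj 0 x), ← proj_add_proj x, mul_add, h, add_zero]
  have h1 : proj 1 x * proj 1 x = proj 1 x := by
    conv_rhs => rw [← mul_one (proj 1 x), ← proj_add_proj x, mul_add, mul_comm _ (proj 0 x), h,
      zero_add]
  have h' : proj 1 x * proj 0 x = 0 := by rw [mul_comm, h]
  fin_cases a <;> fin_cases b
  · exact h0
  · exact h
  · exact h'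
  · exact h1

variable [Fintype V]

theorem Phi_mul_Phi (φ ψ : V → ZMod 2) : Phi φ * Phi ψ = if φ = ψ then Phi φ else 0 := by
  simp only [Phi, ← Finset.prod_mul_distrib, proj_mul_proj]
  split_ifs with h
  · subst h; simp
  · obtain ⟨x, hx⟩ := Function.ne_iff.1 h
    exact Finset.prod_eq_zero (Finset.mem_univ x) (if_neg hx)

theorem sum_Phi [DecidableEq V] : ∑ φ : V → ZMod 2, Phi φ = 1 := by
  simp only [Phi]
  rw [← Fintype.piFinset_univ,
    ← Finset.prod_univ_sum (fun _ => Finset.univ) fun (x : V) (a : ZMod 2) => proj a x]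
  refine Finset.prod_eq_one fun x _ => ?_
  rw [← proj_add_proj x]
  exact Fin.sum_univ_two _

end GroupAlg

namespace BCS

variable {X I : Type*} [DecidableEq I] (B : BCS X I)

theorem Phi_eq_zero {i : I} {φ : B.ctx i → ZMod 2} (h : φ ∉ B.con i) : B.Phi i φ = 0 := by
  have : ConstraintAlg.mk (B.con i) (GroupAlg.Phi φ) = 0 :=
    Ideal.Quotient.eq_zero_iff_mem.2 (Ideal.subset_span ⟨φ, h, rfl⟩)
  rw [Phi, this, map_zero]

theorem isPVM_Phi [DecidableEq X] (i : I) : IsPVM (B.Phi i) where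
  proj φ := by
    refine ⟨?_, ?_⟩
    · rw [IsIdempotentElem, Phi, ← map_mul, ← map_mul, GroupAlg.Phi_mul_Phi, if_pos rfl]
    · rw [IsSelfAdjoint, Phi, StarFreeProduct.star_incl, ConstraintAlg.star_mk,
        GroupAlg.starHom_Phi]
  orth φ ψ h := by
    rw [Phi, Phi, ← map_mul, ← map_mul, GroupAlg.Phi_mul_Phi, if_neg h, map_zero, map_zero]
  sum_eq_one := by
    simp only [Phi]
    rw [← map_sum, ← map_sum, GroupAlg.sum_Phi, map_one, map_one]

end BCS

namespace StarFreeProduct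

variable {I : Type*} [DecidableEq I] (A : I → Type*) [∀ i, Ring (A i)] [∀ i, Algebra ℂ (A i)]

/-- A subalgebra that contains all factors is everything. -/
theorem mem_of_incl_mem (S : Subalgebra ℂ (StarFreeProduct A)) (h : ∀ i a, incl A i a ∈ S)
    (a : StarFreeProduct A) : a ∈ S := by
  let f : StarFreeProduct A →ₐ[ℂ] S := lift A fun i => (incl A i).codRestrict S (h i)
  have hf : S.val.comp f = AlgHom.id ℂ _ := hom_ext A fun i a => by
    change ((f (incl A i a) : S) : StarFreeProduct A) = incl A i a
    rw [lift_incl]; rfl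
  have : ((f a : S) : StarFreeProduct A) = a :=
    congrArg (fun g : StarFreeProduct A →ₐ[ℂ] StarFreeProduct A => g a) hf
  rw [← this]
  exact (f a).2

end StarFreeProduct

namespace TracialState

/-- The elements whose left multiplication is bounded for the trace norm. -/
noncomputable def boundedElements {A : Type*} [Ring A] [StarRing A] [Algebra ℂ A] [StarModule ℂ A]
    (τ : TracialState A) : Subalgebra ℂ A where
  carrier := {a | ∃ C : ℝ, 0 ≤ C ∧ ∀ b, τ.sq (a * b) ≤ C * τ.sq b}
  mul_mem' := by
    rintro a b ⟨C, hC, ha⟩ ⟨D, hD, hb⟩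
    refine ⟨C * D, mul_nonneg hC hD, fun c => ?_⟩
    rw [mul_assoc, mul_assoc]
    exact (ha _).trans (mul_le_mul_of_nonneg_left (hb c) hC)
  add_mem' := by
    rintro a b ⟨C, hC, ha⟩ ⟨D, hD, hb⟩
    refine ⟨2 * C + 2 * D, by positivity, fun c => ?_⟩
    rw [add_mul]
    have := τ.sq_add_le (a * c) (b * c)
    linarith [ha c, hb c]
  algebraMap_mem' r := by
    refine ⟨Complex.normSq r, Complex.normSq_nonneg r, fun b => le_of_eq ?_⟩
    rw [← Algebra.smul_def, sq, star_smul, smul_mul_smul_comm, reTr, map_smul, smul_eq_mul,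
      Complex.star_def, ← Complex.normSq_eq_conj_mul_self, Complex.re_ofReal_mul]
    rfl

theorem bounded_CCAlg {X I : Type*} [DecidableEq I] (B : BCS X I) (τ : TracialState B.CCAlg)
    (a : B.CCAlg) : ∃ C : ℝ, ∀ b, τ.sq (a * b) ≤ C * τ.sq b := by
  suffices h : a ∈ τ.boundedElements by
    obtain ⟨C, -, hC⟩ := h
    exact ⟨C, hC⟩
  refine StarFreeProduct.mem_of_incl_mem _ _ (fun i a => ?_) a
  obtain ⟨a, rfl⟩ := ConstraintAlg.mk_surjective _ a
  induction a using MonoidAlgebra.induction_linear with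
  | zero => rw [map_zero, map_zero]; exact zero_mem _
  | add f g hf hg => rw [map_add, map_add]; exact add_mem hf hg
  | single g c =>
    have hc : MonoidAlgebra.single g c = c • MonoidAlgebra.single g (1 : ℂ) := by
      rw [MonoidAlgebra.smul_single, smul_eq_mul, mul_one]
    rw [hc, map_smul, map_smul]
    refine Subalgebra.smul_mem _ ?_ c
    change ∃ C : ℝ, 0 ≤ C ∧ ∀ b, _
    refine ⟨1, zero_le_one, fun b => le_of_eq ?_⟩
    rw [sq_mul_left, StarFreeProduct.star_incl, ConstraintAlg.star_mk, GroupAlg.starHom_single,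
      ← map_mul, ← map_mul, MonoidAlgebra.single_mul_single, inv_mul_cancel, star_one, mul_one,
      ← MonoidAlgebra.one_def, _root_.map_one, _root_.map_one, mul_one, one_mul, sq]

end TracialState

section PVMHom

variable {V : Type*} [Fintype V] {N : Type*} [Ring N] [StarRing N] [Algebra ℂ N]

/-- The character of `ℤ₂^V` that corresponds to an assignment. -/
noncomputable def assignmentChar (φ : V → ZMod 2) : Z2Pow V →* ℂ where
  toFun g := ∏ x, (-1 : ℂ) ^ (φ x * g.toAdd x).val
  map_one' := by simp
  map_mul' g h := by
    rw [← Finset.prod_mul_distrib]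
    refine Finset.prod_congr rfl fun x _ => ?_
    rw [← neg_one_pow_val_add, toAdd_mul, Pi.add_apply, mul_add]

theorem star_assignmentChar (φ : V → ZMod 2) (g : Z2Pow V) :
    star (assignmentChar φ g) = assignmentChar φ g := by
  simp [assignmentChar]

theorem assignmentChar_inv (φ : V → ZMod 2) (g : Z2Pow V) :
    assignmentChar φ g⁻¹ = assignmentChar φ g := by
  simp [assignmentChar, ZMod.neg_eq_self_mod_two]

variable [DecidableEq V]

theorem assignmentChar_single (φ : V → ZMod 2) (x : V) :
    assignmentChar φ (Multiplicative.ofAdd (Pi.single x 1)) = (-1) ^ (φ x).val := by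
  change ∏ y, (-1 : ℂ) ^ (φ y * (Pi.single x 1 : V → ZMod 2) y).val = _
  rw [Finset.prod_eq_single x]
  · rw [Pi.single_eq_same, mul_one]
  · intro y _ hy
    rw [Pi.single_eq_of_ne hy, mul_zero, ZMod.val_zero, pow_zero]
  · simp

variable {Q : (V → ZMod 2) → N} (hQ : IsPVM Q)

/-- The representation of the group algebra given by a joint measurement of the variables. -/
noncomputable def IsPVM.groupAlgHom (hQ : IsPVM Q) : GroupAlg V →ₐ[ℂ] N :=
  MonoidAlgebra.lift ℂ N (Z2Pow V)
    { toFun := fun g => ∑ φ, assignmentChar φ g • Q φ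
      map_one' := by simp only [map_one, one_smul, hQ.sum_eq_one]
      map_mul' := fun g h => by
        rw [Finset.sum_mul_sum]
        refine Finset.sum_congr rfl fun φ _ => ?_
        simp only [smul_mul_smul_comm, hQ.mul_eq_ite, smul_ite, smul_zero]
        rw [Finset.sum_ite_eq, if_pos (Finset.mem_univ _), map_mul] }

theorem IsPVM.groupAlgHom_single (g : Z2Pow V) (c : ℂ) :
    hQ.groupAlgHom (MonoidAlgebra.single g c) = c • ∑ φ, assignmentChar φ g • Q φ := by
  rw [groupAlgHom, MonoidAlgebra.lift_single]; rfl

theorem IsPVM.groupAlgHom_Phi (ψ : V → ZMod 2) : hQ.groupAlgHom (GroupAlg.Phi ψ) = Q ψ := by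
  have hgen : ∀ x φ, hQ.groupAlgHom (GroupAlg.gen x) * Q φ = (-1 : ℂ) ^ (φ x).val • Q φ := by
    intro x φ
    have : GroupAlg.gen x = MonoidAlgebra.single (Multiplicative.ofAdd (Pi.single x 1)) (1 : ℂ) := by
      unfold GroupAlg.gen
      congr!
    rw [this, groupAlgHom_single, one_smul, Finset.sum_mul]
    simp only [smul_mul_assoc, hQ.mul_eq_ite, smul_ite, smul_zero]
    rw [Finset.sum_ite_eq' , if_pos (Finset.mem_univ _), assignmentChar_single]
  have hproj : ∀ a x φ, hQ.groupAlgHom (GroupAlg.proj a x) * Q φ = if φ x = a then Q φ else 0 := by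
    intro a x φ
    rw [GroupAlg.proj, map_smul, map_add, map_one, map_smul, smul_mul_assoc, add_mul, one_mul,
      smul_mul_assoc, hgen, smul_smul]
    have h : ∀ b : ZMod 2, (1 / 2 : ℂ) • (Q φ + ((-1 : ℂ) ^ a.val * (-1 : ℂ) ^ b.val) • Q φ)
        = if b = a then Q φ else 0 := by
      intro b
      rw [← neg_one_pow_val_add]
      rcases ZMod.two_eq_or_eq_add_one b a with rfl | rfl
      · rw [if_pos rfl, CharTwo.add_self_eq_zero, ZMod.val_zero, pow_zero, one_smul, ← two_smul ℂ,
          smul_smul]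
        norm_num
      · rw [if_neg (ZMod.two_ne_add_one a).symm, ← add_assoc, CharTwo.add_self_eq_zero, zero_add,
          ZMod.val_one, pow_one, neg_one_smul, add_neg_cancel, smul_zero]
    exact h (φ x)
  have hprod : ∀ (s : Finset V) φ, hQ.groupAlgHom (∏ x ∈ s, GroupAlg.proj (ψ x) x) * Q φ
      = if ∀ x ∈ s, φ x = ψ x then Q φ else 0 := by
    intro s φ
    induction s using Finset.induction_on with
    | empty => simp
    | insert x s hx ih =>
      rw [Finset.prod_insert hx, map_mul, mul_assoc, ih]
      simp only [Finset.forall_mem_insert]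
      by_cases h : ∀ x ∈ s, φ x = ψ x
      · rw [if_pos h, hproj]
        exact if_congr ⟨fun hφ => ⟨hφ, h⟩, fun hφ => hφ.1⟩ rfl rfl
      · rw [if_neg h, mul_zero, if_neg fun h' => h h'.2]
  have hP : ∀ φ, hQ.groupAlgHom (GroupAlg.Phi ψ) * Q φ = if φ = ψ then Q φ else 0 := fun φ => by
    rw [GroupAlg.Phi, hprod]
    simp only [Finset.mem_univ, true_implies, funext_iff]
  rw [← mul_one (hQ.groupAlgHom _), ← hQ.sum_eq_one, Finset.mul_sum]
  simp only [hP]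
  rw [Finset.sum_ite_eq', if_pos (Finset.mem_univ _)]

/-- The representation of the algebra of a constraint given by a joint measurement of its
variables that is supported on satisfying assignments. -/
noncomputable def IsPVM.constraintHom {C : Finset (V → ZMod 2)} (h : ∀ φ ∉ C, Q φ = 0) :
    ConstraintAlg C →ₐ[ℂ] N :=
  Ideal.Quotient.liftₐ (constraintIdeal C) hQ.groupAlgHom fun a ha => by
    have hle : constraintIdeal C ≤ RingHom.ker hQ.groupAlgHom := by
      refine Ideal.span_le.2 ?_
      rintro _ ⟨φ, hφ, rfl⟩
      change hQ.groupAlgHom _ = 0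
      rw [hQ.groupAlgHom_Phi, h φ hφ]
    exact hle ha

theorem IsPVM.constraintHom_mk {C : Finset (V → ZMod 2)} (h : ∀ φ ∉ C, Q φ = 0) (a : GroupAlg V) :
    hQ.constraintHom h (ConstraintAlg.mk C a) = hQ.groupAlgHom a := rfl

theorem IsPVM.constraintHom_star [StarModule ℂ N] {C : Finset (V → ZMod 2)}
    (h : ∀ φ ∉ C, Q φ = 0) (a : ConstraintAlg C) :
    hQ.constraintHom h (star a) = star (hQ.constraintHom h a) := by
  obtain ⟨a, rfl⟩ := ConstraintAlg.mk_surjective _ a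
  rw [ConstraintAlg.star_mk, constraintHom_mk, constraintHom_mk]
  induction a using MonoidAlgebra.induction_linear with
  | zero => simp only [map_zero, star_zero]
  | add f g hf hg => rw [map_add, map_add, map_add, star_add, hf, hg]
  | single g c =>
    rw [GroupAlg.starHom_single, groupAlgHom_single, groupAlgHom_single, star_smul, star_sum]
    simp only [star_smul, star_assignmentChar, assignmentChar_inv,
      (hQ.proj _).isSelfAdjoint.star_eq]

end PVMHom

/-- Joint measurements of satisfying assignments, one for each constraint, give a tracial state on
the constraint-constraint algebra. -/
theorem BCS.exists_tracialState_of_pvm {X I : Type*} [DecidableEq X] [DecidableEq I] (B : BCS X I)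
    {N : Type*} [Ring N] [StarRing N] [Algebra ℂ N] [StarModule ℂ N] (τ : TracialState N)
    {Q : ∀ i, (B.ctx i → ZMod 2) → N} (hQ : ∀ i, IsPVM (Q i)) (h : ∀ i, ∀ φ ∉ B.con i, Q i φ = 0) :
    ∃ τ' : TracialState B.CCAlg, ∀ i j φ ψ,
      τ'.sq (B.Phi i φ * B.Phi j ψ) = τ.sq (Q i φ * Q j ψ) := by
  let F : B.CCAlg →ₐ[ℂ] N := StarFreeProduct.lift _ fun i => (hQ i).constraintHom (h i)
  have hF : ∀ i a, F (StarFreeProduct.incl _ i a) = (hQ i).constraintHom (h i) a :=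
    StarFreeProduct.lift_incl _ _
  let S : Subalgebra ℂ B.CCAlg :=
    { carrier := {a | F (star a) = star (F a)}
      mul_mem' := fun {a b} ha hb => by
        change F (star (a * b)) = star (F (a * b))
        rw [star_mul, map_mul, map_mul, star_mul, ha, hb]
      add_mem' := fun {a b} ha hb => by
        change F (star (a + b)) = star (F (a + b))
        rw [star_add, map_add, map_add, star_add, ha, hb]
      algebraMap_mem' := fun r => by
        change F (star _) = star (F _)
        rw [← algebraMap_star_comm, AlgHom.commutes, AlgHom.commutes, algebraMap_star_comm] }
  have hstar : ∀ a, F (star a) = star (F a) := StarFreeProduct.mem_of_incl_mem _ S fun i a => by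
    change F (star _) = star (F _)
    rw [StarFreeProduct.star_incl, hF, hF, IsPVM.constraintHom_star]
  let τ' : TracialState B.CCAlg :=
    { toLinearMap := τ.toLinearMap ∘ₗ F.toLinearMap
      map_one := by
        change τ.toLinearMap (F 1) = 1
        rw [map_one, τ.map_one]
      map_star := fun a => by
        change τ.toLinearMap (F (star a)) = star (τ.toLinearMap (F a))
        rw [hstar, τ.map_star]
      nonneg := fun a => by
        change 0 ≤ τ.toLinearMap (F (star a * a))
        rw [map_mul, hstar]; exact τ.nonneg _
      tracial := fun a b => by
        change τ.toLinearMap (F (a * b)) = τ.toLinearMap (F (b * a))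
        rw [map_mul F, map_mul F, τ.tracial] }
  have hPhi : ∀ i φ, F (B.Phi i φ) = Q i φ := fun i φ => by
    rw [BCS.Phi, hF, IsPVM.constraintHom_mk, IsPVM.groupAlgHom_Phi]
  refine ⟨τ', fun i j φ ψ => ?_⟩
  change (τ.toLinearMap (F (star (B.Phi i φ * B.Phi j ψ) * (B.Phi i φ * B.Phi j ψ)))).re = _
  rw [map_mul F, hstar, map_mul F, hPhi, hPhi]; rfl

namespace BCS

variable {X I : Type*} [DecidableEq I] (B : BCS X I) (τ : TracialState B.CCAlg)

/-- The unweighted contribution of a pair of constraints to the defect. -/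
noncomputable def gap (i j : I) : ℝ :=
  open Classical in
  ∑ φ ∈ B.con i, ∑ ψ ∈ B.con j, if B.Agree φ ψ then 0 else τ.sq (B.Phi i φ * B.Phi j ψ)

theorem gap_nonneg (i j : I) : 0 ≤ B.gap τ i j := by
  refine Finset.sum_nonneg fun φ _ => Finset.sum_nonneg fun ψ _ => ?_
  split_ifs
  exacts [le_rfl, τ.sq_nonneg _]

theorem defect_ccWeight [Fintype I] (π : I × I → ℝ≥0) :
    τ.defect (B.ccWeight π) = ∑ i, ∑ j, (π (i, j) : ℝ) * B.gap τ i j := by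
  classical
  let F : (B.CCAlg →₀ ℝ≥0) →+ ℝ := Finsupp.liftAddHom fun a =>
    (AddMonoidHom.mulRight (τ.sq a)).comp (NNReal.toRealHom : ℝ≥0 →+ ℝ)
  have hF : ∀ a w, F (Finsupp.single a w) = w * τ.sq a := fun a w =>
    Finsupp.liftAddHom_apply_single _ _ _
  have h : τ.defect (B.ccWeight π) = F (B.ccWeight π) := by
    change (B.ccWeight π).sum _ = (B.ccWeight π).sum _
    refine Finsupp.sum_congr fun a _ => ?_
    rw [τ.norm_sq]; rfl
  rw [h, ccWeight]
  simp only [map_sum, apply_ite F, map_zero, hF, gap, Finset.mul_sum, mul_ite, mul_zero]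

theorem sq_marginal_sub_marginal_le [DecidableEq X] {i j : I} {x : X} (hi : x ∈ B.ctx i)
    (hj : x ∈ B.ctx j) :
    τ.sq (marginal (B.Phi i) ⟨x, hi⟩ 0 - marginal (B.Phi j) ⟨x, hj⟩ 0) ≤ B.gap τ i j := by
  classical
  rw [τ.sq_marginal_sub_marginal (B.isPVM_Phi i) (B.isPVM_Phi j), gap,
    ← Finset.sum_subset (Finset.subset_univ (B.con i)) fun φ _ hφ =>
      Finset.sum_eq_zero fun ψ _ => by rw [B.Phi_eq_zero hφ, zero_mul, τ.sq_zero, ite_self]]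
  refine Finset.sum_le_sum fun φ _ => ?_
  rw [← Finset.sum_subset (Finset.subset_univ (B.con j)) fun ψ _ hψ => by
    rw [B.Phi_eq_zero hψ, mul_zero, τ.sq_zero, ite_self]]
  refine Finset.sum_le_sum fun ψ _ => ?_
  by_cases h : φ ⟨x, hi⟩ = ψ ⟨x, hj⟩
  · rw [if_pos h]
    split_ifs
    exacts [le_rfl, τ.sq_nonneg _]
  · rw [if_neg h, if_neg fun h' => h (h' x hi hj)]

theorem gap_le_card_mul [DecidableEq X] {N : Type*} [Ring N] [StarRing N] [Algebra ℂ N]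
    (σ : TracialState N) {Q : ∀ i, (B.ctx i → ZMod 2) → N} (hQ : ∀ i, IsPVM (Q i))
    (hsq : ∀ i j φ ψ, τ.sq (B.Phi i φ * B.Phi j ψ) = σ.sq (Q i φ * Q j ψ)) (i j : I) {c : ℝ}
    (hc : 0 ≤ c)
    (h : ∀ x (hi : x ∈ B.ctx i) (hj : x ∈ B.ctx j),
      σ.sq (marginal (Q i) ⟨x, hi⟩ 0 - marginal (Q j) ⟨x, hj⟩ 0) ≤ c) :
    B.gap τ i j ≤ (B.ctx i).card * c := by
  classical
  have key : ∀ φ ψ, (if B.Agree φ ψ then 0 else τ.sq (B.Phi i φ * B.Phi j ψ))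
      ≤ ∑ x : B.ctx i, if hj : x.1 ∈ B.ctx j then
          (if φ x = ψ ⟨x.1, hj⟩ then 0 else σ.sq (Q i φ * Q j ψ)) else 0 := fun φ ψ => by
    have hnn : ∀ x ∈ Finset.univ, 0 ≤ if hj : x.1 ∈ B.ctx j then
        (if φ x = ψ ⟨x.1, hj⟩ then 0 else σ.sq (Q i φ * Q j ψ)) else 0 := fun x _ => by
      split_ifs
      exacts [le_rfl, σ.sq_nonneg _, le_rfl]
    split_ifs with hA
    · exact Finset.sum_nonneg hnn
    · simp only [Agree, not_forall] at hA
      obtain ⟨x, hi, hj, hne⟩ := hA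
      refine le_trans (le_of_eq ?_) (Finset.single_le_sum hnn (Finset.mem_univ ⟨x, hi⟩))
      rw [dif_pos hj, if_neg hne, hsq]
  have hnn : ∀ φ ψ, 0 ≤ if B.Agree φ ψ then 0 else τ.sq (B.Phi i φ * B.Phi j ψ) := fun φ ψ => by
    split_ifs
    exacts [le_rfl, τ.sq_nonneg _]
  calc B.gap τ i j
      ≤ ∑ φ, ∑ ψ, if B.Agree φ ψ then 0 else τ.sq (B.Phi i φ * B.Phi j ψ) :=
        (Finset.sum_le_sum fun φ _ => Finset.sum_le_univ_sum_of_nonneg fun ψ => hnn φ ψ).trans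
          (Finset.sum_le_univ_sum_of_nonneg fun φ => Finset.sum_nonneg fun ψ _ => hnn φ ψ)
    _ ≤ ∑ φ, ∑ ψ, ∑ x : B.ctx i, if hj : x.1 ∈ B.ctx j then
          (if φ x = ψ ⟨x.1, hj⟩ then 0 else σ.sq (Q i φ * Q j ψ)) else 0 :=
        Finset.sum_le_sum fun φ _ => Finset.sum_le_sum fun ψ _ => key φ ψ
    _ = ∑ x : B.ctx i, ∑ φ, ∑ ψ, if hj : x.1 ∈ B.ctx j then
          (if φ x = ψ ⟨x.1, hj⟩ then 0 else σ.sq (Q i φ * Q j ψ)) else 0 := by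
        rw [Finset.sum_comm]
        refine (Finset.sum_congr rfl fun φ _ => Finset.sum_comm).trans ?_
        rw [Finset.sum_comm]
        exact Finset.sum_congr rfl fun x _ => Finset.sum_comm
    _ ≤ ∑ x : B.ctx i, c := by
        refine Finset.sum_le_sum fun x _ => ?_
        by_cases hj : x.1 ∈ B.ctx j
        · simp only [dif_pos hj]
          rw [← σ.sq_marginal_sub_marginal (hQ i) (hQ j)]
          exact h x.1 x.2 hj
        · simp only [dif_neg hj, Finset.sum_const_zero]
          exact hc
    _ = (B.ctx i).card * c := by
        rw [Finset.sum_const, Finset.card_univ, Fintype.card_coe, nsmul_eq_mul]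

end BCS

theorem BCS.card_ctx_le_maxCtx {X I : Type*} [Fintype I] (B : BCS X I) (i : I) :
    (B.ctx i).card ≤ B.maxCtx :=
  Finset.le_sup (f := fun i => (B.ctx i).card) (Finset.mem_univ i)

theorem TracialState.roundingBound_nonneg {k n : ℝ} (hk : 0 ≤ k) (hn : 0 ≤ n) :
    0 ≤ roundingBound k n := by
  unfold roundingBound; positivity

theorem TracialState.roundingBound_mono {k n k' n' : ℝ} (hk : 0 ≤ k) (hn : 0 ≤ n) (hk' : k ≤ k')
    (hn' : n ≤ n') : roundingBound k n ≤ roundingBound k' n' := by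
  have : 0 ≤ k' := hk.trans hk'
  have : 0 ≤ n' := hn.trans hn'
  unfold roundingBound
  gcongr

/-- The weighted sum of the losses for a diagonally dominant distribution. -/
theorem DiagonallyDominant.sum_mul_le {A : Type*} [Fintype A] {C : ℝ≥0} (hC : 0 < C)
    {π : A × A → ℝ≥0} (h : DiagonallyDominant C π) {c : ℝ} (hc : 0 ≤ c) {Δ : A → ℝ}
    (hΔ : ∀ a, 0 ≤ Δ a) {G : A → A → ℝ} (hΔG : ∀ a, Δ a = G a a) (hG : ∀ a b, 0 ≤ G a b) :
    ∑ a, ∑ b, (π (a, b) : ℝ) * (c * Δ a + G a b + c * Δ b)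
      ≤ (2 * c * (C : ℝ)⁻¹ + 1) * ∑ a, ∑ b, (π (a, b) : ℝ) * G a b := by
  have hC' : (0 : ℝ) < C := hC
  have hdiag : ∑ a, (π (a, a) : ℝ) * Δ a ≤ ∑ a, ∑ b, (π (a, b) : ℝ) * G a b :=
    Finset.sum_le_sum fun a _ => by
      rw [hΔG]
      exact Finset.single_le_sum (f := fun b => (π (a, b) : ℝ) * G a b)
        (fun b _ => mul_nonneg (π (a, b)).coe_nonneg (hG a b)) (Finset.mem_univ a)
  have hrow : ∀ a, ∑ b, (π (a, b) : ℝ) ≤ (C : ℝ)⁻¹ * π (a, a) := fun a => by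
    rw [le_inv_mul_iff₀ hC']
    exact_mod_cast (h a).1
  have hcol : ∀ a, ∑ b, (π (b, a) : ℝ) ≤ (C : ℝ)⁻¹ * π (a, a) := fun a => by
    rw [le_inv_mul_iff₀ hC']
    exact_mod_cast (h a).2
  have h1 : ∑ a, ∑ b, (π (a, b) : ℝ) * Δ a ≤ (C : ℝ)⁻¹ * ∑ a, (π (a, a) : ℝ) * Δ a := by
    rw [Finset.mul_sum]
    refine Finset.sum_le_sum fun a _ => ?_
    rw [← Finset.sum_mul, ← mul_assoc]
    exact mul_le_mul_of_nonneg_right (hrow a) (hΔ a)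
  have h2 : ∑ a, ∑ b, (π (a, b) : ℝ) * Δ b ≤ (C : ℝ)⁻¹ * ∑ a, (π (a, a) : ℝ) * Δ a := by
    rw [Finset.sum_comm, Finset.mul_sum]
    refine Finset.sum_le_sum fun a _ => ?_
    rw [← Finset.sum_mul, ← mul_assoc]
    exact mul_le_mul_of_nonneg_right (hcol a) (hΔ a)
  have hsplit : ∑ a, ∑ b, (π (a, b) : ℝ) * (c * Δ a + G a b + c * Δ b)
      = c * ∑ a, ∑ b, (π (a, b) : ℝ) * Δ a + ∑ a, ∑ b, (π (a, b) : ℝ) * G a b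
        + c * ∑ a, ∑ b, (π (a, b) : ℝ) * Δ b := by
    simp only [Finset.mul_sum, ← Finset.sum_add_distrib]
    exact Finset.sum_congr rfl fun a _ => Finset.sum_congr rfl fun b _ => by ring
  have h3 : (C : ℝ)⁻¹ * ∑ a, (π (a, a) : ℝ) * Δ a
      ≤ (C : ℝ)⁻¹ * ∑ a, ∑ b, (π (a, b) : ℝ) * G a b :=
    mul_le_mul_of_nonneg_left hdiag (inv_nonneg.2 hC'.le)
  rw [hsplit]
  have h4 := mul_le_mul_of_nonneg_left (h1.trans h3) hc
  have h5 := mul_le_mul_of_nonneg_left (h2.trans h3) hc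
  linarith

/-- The gap between two constraints, summed over the clauses of a subdivision. -/
noncomputable def clauseGap {X : Type*} {m : ℕ} {n : Fin m → ℕ}
    (B' : BCS X (Σ i : Fin m, Fin (n i))) (τ : TracialState B'.CCAlg) (i k : Fin m) : ℝ :=
  ∑ j, ∑ l, B'.gap τ ⟨i, j⟩ ⟨k, l⟩

theorem clauseGap_nonneg {X : Type*} {m : ℕ} {n : Fin m → ℕ}
    (B' : BCS X (Σ i : Fin m, Fin (n i))) (τ : TracialState B'.CCAlg) (i k : Fin m) :
    0 ≤ clauseGap B' τ i k :=
  Finset.sum_nonneg fun _ _ => Finset.sum_nonneg fun _ _ => B'.gap_nonneg τ _ _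

theorem gap_le_clauseGap {X : Type*} {m : ℕ} {n : Fin m → ℕ}
    (B' : BCS X (Σ i : Fin m, Fin (n i))) (τ : TracialState B'.CCAlg) {i k : Fin m} (j : Fin (n i))
    (l : Fin (n k)) : B'.gap τ ⟨i, j⟩ ⟨k, l⟩ ≤ clauseGap B' τ i k :=
  (Finset.single_le_sum (f := fun l => B'.gap τ ⟨i, j⟩ ⟨k, l⟩) (fun _ _ => B'.gap_nonneg τ _ _)
    (Finset.mem_univ l)).trans
  (Finset.single_le_sum (f := fun j => ∑ l, B'.gap τ ⟨i, j⟩ ⟨k, l⟩)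
    (fun _ _ => Finset.sum_nonneg fun _ _ => B'.gap_nonneg τ _ _) (Finset.mem_univ j))

theorem sum_mul_clauseGap_le {X : Type*} {m : ℕ} {n : Fin m → ℕ} (hn : ∀ i, 1 ≤ n i)
    (B' : BCS X (Σ i : Fin m, Fin (n i))) (τ : TracialState B'.CCAlg)
    (π : Fin m × Fin m → ℝ≥0) :
    ∑ i, ∑ k, (π (i, k) : ℝ) * clauseGap B' τ i k
      ≤ ((Finset.univ.sup n : ℕ) : ℝ) ^ 2 * τ.defect (B'.ccWeight (subDist n π)) := by
  have hM : ∀ i, (n i : ℝ) ≤ ((Finset.univ.sup n : ℕ) : ℝ) := fun i => by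
    exact_mod_cast Finset.le_sup (f := n) (Finset.mem_univ i)
  rw [B'.defect_ccWeight, Finset.mul_sum]
  have hre : ∑ a : (Σ i : Fin m, Fin (n i)), ((Finset.univ.sup n : ℕ) : ℝ) ^ 2 *
        ∑ b : (Σ i : Fin m, Fin (n i)), (subDist n π (a, b) : ℝ) * B'.gap τ a b
      = ∑ i, ∑ k, ∑ j, ∑ l, ((Finset.univ.sup n : ℕ) : ℝ) ^ 2 *
        ((subDist n π (⟨i, j⟩, ⟨k, l⟩) : ℝ) * B'.gap τ ⟨i, j⟩ ⟨k, l⟩) := by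
    simp only [Fintype.sum_sigma, Finset.mul_sum]
    exact Finset.sum_congr rfl fun i _ => Finset.sum_comm
  rw [hre]
  refine Finset.sum_le_sum fun i _ => Finset.sum_le_sum fun k _ => ?_
  rw [clauseGap, Finset.mul_sum]
  refine Finset.sum_le_sum fun j _ => ?_
  rw [Finset.mul_sum]
  refine Finset.sum_le_sum fun l _ => ?_
  rw [← mul_assoc]
  refine mul_le_mul_of_nonneg_right ?_ (B'.gap_nonneg τ _ _)
  have hi : (0 : ℝ) < n i := by exact_mod_cast hn i
  have hk : (0 : ℝ) < n k := by exact_mod_cast hn k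
  have hs : (subDist n π (⟨i, j⟩, ⟨k, l⟩) : ℝ) = π (i, k) / (n i * n k) := by
    simp [subDist]
  rw [hs, mul_div_assoc', le_div_iff₀ (mul_pos hi hk), mul_comm]
  refine mul_le_mul_of_nonneg_right ?_ (π (i, k)).coe_nonneg
  rw [pow_two]
  exact mul_le_mul (hM i) (hM k) hk.le (hi.le.trans (hM i))

/-- A subdivision bounds the gaps of the original system, uniformly in the number of
constraints. -/
theorem IsSubdivision.exists_tracialState {X : Type*} {m : ℕ} {n : Fin m → ℕ} {B : BCS X (Fin m)}
    {B' : BCS X (Σ i : Fin m, Fin (n i))} (hsub : IsSubdivision B B')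
    (hne : ∀ i, (B.con i).Nonempty) (τ : TracialState B'.CCAlg) {c : ℝ}
    (hc : ∀ i, TracialState.roundingBound (B.ctx i).card (n i) ≤ c) :
    ∃ τ' : TracialState B.CCAlg, ∀ i k, B.gap τ' i k ≤ (B.ctx i).card *
      (3 * (c * clauseGap B' τ i i + clauseGap B' τ i k + c * clauseGap B' τ k k)) := by
  classical
  obtain ⟨N, _, _, _, _, σ, ρ, hρ, hcut, hrow⟩ :=
    τ.exists_vonNeumann_extension (TracialState.bounded_CCAlg B' τ)
  have hρsq : ∀ a, σ.sq (ρ a) = τ.sq a := fun a => by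
    rw [TracialState.sq, ← map_star, ← map_mul, TracialState.reTr, hρ]; rfl
  let R : ∀ a, (B'.ctx a → ZMod 2) → N := fun a ψ => ρ (B'.Phi a ψ)
  have hR : ∀ a, IsPVM (R a) := fun a =>
    { proj := fun ψ => ((B'.isPVM_Phi a).proj ψ).map ρ
      orth := fun φ ψ h => by
        change ρ _ * ρ _ = 0
        rw [← map_mul, (B'.isPVM_Phi a).orth _ _ h, map_zero]
      sum_eq_one := by
        change ∑ ψ, ρ _ = 1
        rw [← map_sum, (B'.isPVM_Phi a).sum_eq_one, map_one] }
  have hRgap : ∀ a b x (ha : x ∈ B'.ctx a) (hb : x ∈ B'.ctx b),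
      σ.sq (marginal (R a) ⟨x, ha⟩ 0 - marginal (R b) ⟨x, hb⟩ 0) ≤ B'.gap τ a b :=
    fun a b x ha hb => by
      refine le_trans (le_of_eq ?_) (B'.sq_marginal_sub_marginal_le τ ha hb)
      rw [← hρsq, map_sub]
      simp only [marginal, map_sum, R]
  have hΔ := fun i => clauseGap_nonneg B' τ i i
  let emb : ∀ i j, B'.ctx ⟨i, j⟩ → B.ctx i := fun i j x => ⟨x.1, hsub.subset i j x.2⟩
  have hex : ∀ i, ∃ Q : (B.ctx i → ZMod 2) → N, IsPVM Q ∧ (∀ φ ∉ B.con i, Q φ = 0) ∧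
      ∀ j (v : B'.ctx ⟨i, j⟩), σ.sq (marginal Q (emb i j v) 0 - marginal (R ⟨i, j⟩) v 0)
        ≤ c * clauseGap B' τ i i := fun i => by
    obtain ⟨Q, hQ, hQC, hQR⟩ := σ.exists_constraint_pvm hcut hrow (emb i)
      (fun j u v h => Subtype.ext (congrArg (fun z : B.ctx i => z.1) h))
      (fun x y => by
        obtain ⟨j, hx, hy⟩ := hsub.pair i x.1 x.2 y.1 y.2
        exact ⟨j, ⟨x.1, hx⟩, ⟨y.1, hy⟩, rfl, rfl⟩)
      (R := fun j => R ⟨i, j⟩) (fun j => hR _) (C := B.con i) (D := fun j => B'.con ⟨i, j⟩)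
      (fun j ψ hψ => by
        change ρ _ = 0
        rw [B'.Phi_eq_zero hψ, map_zero])
      (fun φ h => (hsub.conj i φ).2 h) (hne i) (hΔ i)
      (fun j l u v h => by
        have huv : u.1 = v.1 := congrArg (fun z : B.ctx i => z.1) h
        obtain ⟨u, hu⟩ := u
        obtain ⟨v, hv⟩ := v
        obtain rfl : u = v := huv
        exact (hRgap _ _ u hu hv).trans (gap_le_clauseGap B' τ j l))
    refine ⟨Q, hQ, hQC, fun j v => (hQR j v).trans (mul_le_mul_of_nonneg_right ?_ (hΔ i))⟩
    rw [Fintype.card_coe, Fintype.card_fin]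
    exact hc i
  choose Q hQ hQC hQR using hex
  obtain ⟨τ', hτ'⟩ := B.exists_tracialState_of_pvm σ hQ hQC
  refine ⟨τ', fun i k => ?_⟩
  have hc0 : 0 ≤ c := le_trans
    (TracialState.roundingBound_nonneg (Nat.cast_nonneg _) (Nat.cast_nonneg _)) (hc i)
  refine B.gap_le_card_mul τ' σ hQ hτ' i k ?_ fun x hi hk => ?_
  · have := mul_nonneg hc0 (hΔ i)
    have := mul_nonneg hc0 (hΔ k)
    have := clauseGap_nonneg B' τ i k
    positivity
  · obtain ⟨j, hj, -⟩ := hsub.pair i x hi x hi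
    obtain ⟨l, hl, -⟩ := hsub.pair k x hk x hk
    have h1 := hQR i j ⟨x, hj⟩
    have h2 := (hRgap _ _ x hj hl).trans (gap_le_clauseGap B' τ j l)
    have h3 := hQR k l ⟨x, hl⟩
    rw [TracialState.sq_sub_comm] at h3
    have hsplit : marginal (Q i) ⟨x, hi⟩ 0 - marginal (Q k) ⟨x, hk⟩ 0
        = (marginal (Q i) ⟨x, hi⟩ 0 - marginal (R ⟨i, j⟩) ⟨x, hj⟩ 0)
          + (marginal (R ⟨i, j⟩) ⟨x, hj⟩ 0 - marginal (R ⟨k, l⟩) ⟨x, hl⟩ 0)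
          + (marginal (R ⟨k, l⟩) ⟨x, hl⟩ 0 - marginal (Q k) ⟨x, hk⟩ 0) := by abel
    rw [hsplit]
    refine (σ.sq_add_three_le _ _ _).trans ?_
    exact mul_le_mul_of_nonneg_left (add_le_add (add_le_add h1 h2) h3) (by norm_num)

theorem exists_eval_eq_roundingBound (C : ℝ) : ∃ P : MvPolynomial (Fin 3) ℝ, ∀ a M K : ℝ,
    MvPolynomial.eval ![a, M, K] P
      = 3 * K * (2 * TracialState.roundingBound K M * C⁻¹ + 1) * M ^ 2 := by
  let K : MvPolynomial (Fin 3) ℝ := .X 2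
  let M : MvPolynomial (Fin 3) ℝ := .X 1
  refine ⟨3 * K * (2 * (2 * (32 * (1104 * K ^ 3 + 2 * K ^ 2)
    + M * K * (2 * (32 * (1104 * K ^ 3 + 2 * K ^ 2)) + 2)) + 2) * .C C⁻¹ + 1) * M ^ 2,
    fun a m k => ?_⟩
  simp [K, M, TracialState.roundingBound]

theorem mainTheorem7 (C : ℝ≥0) (hC : 0 < C) :
    ∃ P : MvPolynomial (Fin 3) ℝ,
      ∀ (X : Type*) (m : ℕ) (n : Fin m → ℕ)
        (B : BCS X (Fin m)) (B' : BCS X (Σ i : Fin m, Fin (n i)))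
        (π : Fin m × Fin m → ℝ≥0),
        (∀ i, (B.con i).Nonempty) →
        IsSubdivision B B' →
        ∑ p, π p = 1 →
        DiagonallyDominant C π →
        ∀ τ : TracialState B'.CCAlg, ∃ τ' : TracialState B.CCAlg,
          τ'.defect (B.ccWeight π) ≤
            MvPolynomial.eval ![(2 : ℝ) ^ B'.maxCtx, ((Finset.univ.sup n : ℕ) : ℝ), ((B.maxCtx : ℕ) : ℝ)] P *
              τ.defect (B'.ccWeight (subDist n π)) := by
  obtain ⟨P, hP⟩ := exists_eval_eq_roundingBound C
  refine ⟨P, fun X m n B B' π hne hsub _ hdom τ => ?_⟩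
  rw [hP]
  set M : ℝ := ((Finset.univ.sup n : ℕ) : ℝ)
  set K : ℝ := ((B.maxCtx : ℕ) : ℝ)
  set c := TracialState.roundingBound K M
  have hK : ∀ i, ((B.ctx i).card : ℝ) ≤ K := fun i => Nat.cast_le.2 (B.card_ctx_le_maxCtx i)
  have hM : ∀ i, (n i : ℝ) ≤ M := fun i =>
    Nat.cast_le.2 (Finset.le_sup (f := n) (Finset.mem_univ i))
  have hK0 : 0 ≤ K := Nat.cast_nonneg _
  have hc0 : 0 ≤ c := TracialState.roundingBound_nonneg hK0 (Nat.cast_nonneg _)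
  have hG := clauseGap_nonneg B' τ
  obtain ⟨τ', hτ'⟩ := hsub.exists_tracialState hne τ (c := c) fun i =>
    TracialState.roundingBound_mono (Nat.cast_nonneg _) (Nat.cast_nonneg _) (hK i) (hM i)
  refine ⟨τ', ?_⟩
  calc τ'.defect (B.ccWeight π)
      = ∑ i, ∑ k, (π (i, k) : ℝ) * B.gap τ' i k := B.defect_ccWeight τ' π
    _ ≤ ∑ i, ∑ k, 3 * K * ((π (i, k) : ℝ) *
          (c * clauseGap B' τ i i + clauseGap B' τ i k + c * clauseGap B' τ k k)) := by
        refine Finset.sum_le_sum fun i _ => Finset.sum_le_sum fun k _ => ?_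
        have h0 : 0 ≤ c * clauseGap B' τ i i + clauseGap B' τ i k + c * clauseGap B' τ k k :=
          add_nonneg (add_nonneg (mul_nonneg hc0 (hG i i)) (hG i k)) (mul_nonneg hc0 (hG k k))
        have h1 := mul_le_mul_of_nonneg_left ((hτ' i k).trans
          (mul_le_mul_of_nonneg_right (hK i) (mul_nonneg zero_le_three h0)))
          (π (i, k)).coe_nonneg
        linarith
    _ = 3 * K * ∑ i, ∑ k, (π (i, k) : ℝ) *
          (c * clauseGap B' τ i i + clauseGap B' τ i k + c * clauseGap B' τ k k) := by
        simp only [Finset.mul_sum]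
    _ ≤ 3 * K * ((2 * c * (C : ℝ)⁻¹ + 1) *
          ∑ i, ∑ k, (π (i, k) : ℝ) * clauseGap B' τ i k) :=
        mul_le_mul_of_nonneg_left (hdom.sum_mul_le hC hc0 (fun i => hG i i) (fun _ => rfl) hG)
          (by positivity)
    _ ≤ 3 * K * ((2 * c * (C : ℝ)⁻¹ + 1) *
          (M ^ 2 * τ.defect (B'.ccWeight (subDist n π)))) := by
        gcongr
        exact sum_mul_clauseGap_le hsub.one_le B' τ π
    _ = 3 * K * (2 * c * (C : ℝ)⁻¹ + 1) * M ^ 2 * τ.defect (B'.ccWeight (subDist n π)) := by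
        ring
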